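/- Notation. For $(z,w)\in\mathbb C^2$ put $\xi=z+iw$, $\bar\xi=\bar z-i\bar w$, $\xi^*=\bar z+i\bar w$, $\tilde\xi=z-iw$, and $$A_\xi=\tfrac12(\partial_z-i\partial_w),\quad A_{\bar\xi}=\tfrac12(\partial_{\bar z}+i\partial_{\bar w}),\quad A_{\xi^*}=\tfrac12(\partial_{\bar z}-i\partial_{\bar w}),\quad A_{\tilde\xi}=\tfrac12(\partial_z+i\partial_w).$$ Let $\Delta=\partial_z\partial_{\bar z}+\partial_w\partial_{\bar w}$, $\Box=\partial_z\partial_{\bar w}-\partial_w\partial_{\bar z}$ and $$S_\xi=-\tfrac14\bigl(\Delta+i\Box-2(z\partial_z+w\partial_w)+2i(z\partial_w-w\partial_z)\bigr),\qquad S_{\xi^*}=-\tfrac14\bigl(\Delta-i\Box-2(\bar z\partial_{\bar z}+\bar w\partial_{\bar w})+2i(\bar z\partial_{\bar w}-\bar w\partial_{\bar z})\bigr),$$ and let $S_{\bar\xi}$, $S_{\tilde\xi}$ be the complex conjugates of $S_\xi$, $S_{\xi^*}$, i.e. $\overline{P}f:=\overline{P\bar f}$. Let $H_{m,n}(z,\bar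 z)=(-1)^{m+n}e^{|z|^2}\partial_{\bar z}^m\partial_z^n e^{-|z|^2}$ and, for $M=(m,n,m',n')\in\mathbb N^4$ (with $0\in\mathbb N$), $H_M(z,w)=H_{m,n}(\xi,\bar\xi)\,H_{m',n'}(\xi^*,\tilde\xi)$. Let $\mathcal H=L^2(\mathbb C^2,e^{-2(|z|^2+|w|^2)}d\lambda)$, where $\lambda$ is Lebesgue measure. Theorem. On smooth functions, $$S_\xi=\xi A_\xi-A_\xi A_{\bar\xi},\quad S_{\bar\xi}=\bar\xi A_{\bar\xi}-A_\xi A_{\bar\xi},\quad S_{\xi^*}=\xi^*A_{\xi^*}-A_{\xi^*}A_{\tilde\xi},\quad S_{\tilde\xi}=\tilde\xi A_{\tilde\xi}-A_{\xi^*}A_{\tilde\xi}.$$ Let $S$ be one of $S_\xi,S_{\bar\xi},S_{\xi^*},S_{\tilde\xi}$ and, for $M=(m,n,m',n')$, let $M_S$ be $m,n,m',n'$, respectively. Then $S$ with domain $C_c^\infty(\mathbb C^2)$ is essentially self-adjoint in $\mathcal H$; denote its closure by $S$ again. The spectrum of $S$ in $\mathcal H$ is purely discrete, in the sense that it is a closed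 set of isolated points, each of which is an eigenvalue (multiplicities may be infinite), and the eigenvectors span a dense subspace of $\mathcal H$. The spectrum is $\{0,1,2,\dots\}$. Every $H_M$ is a nonzero element of $\mathcal H$ lying in the domain of $S$, and $SH_M=M_S\,H_M$; moreover, for every $\ell=0,1,2,\dots$, the eigenspace of $S$ for $\ell$ is the closed linear span in $\mathcal H$ of the $H_M$ with $M_S=\ell$. -/

import Mathlib

open MeasureTheory Complex
open scoped ContDiff ComplexConjugate

noncomputable section

namespace BivariateHermite

/-! ### Univariate and bivariate complex Hermite polynomials -/

/-- The Wirtinger derivative `∂/∂z = (∂/∂x - i ∂/∂y)/2` of a function on `ℂ`. -/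
def wirtinger (f : ℂ → ℂ) (z : ℂ) : ℂ :=
  (1 / 2) * (fderiv ℝ f z 1 - I * fderiv ℝ f z I)

/-- The Wirtinger derivative `∂/∂z̄ = (∂/∂x + i ∂/∂y)/2` of a function on `ℂ`. -/
def wirtingerBar (f : ℂ → ℂ) (z : ℂ) : ℂ :=
  (1 / 2) * (fderiv ℝ f z 1 + I * fderiv ℝ f z I)

/-- The univariate complex Hermite polynomial
`H_{m,n}(z, z̄) = (-1)^{m+n} e^{|z|²} ∂^{m+n}/∂z̄^m∂z^n e^{-|z|²}` (Rodrigues' formula). -/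
def univHermite (m n : ℕ) (z : ℂ) : ℂ :=
  (-1) ^ (m + n) * (Real.exp (‖z‖ ^ 2) : ℂ) *
    (wirtingerBar^[m] (wirtinger^[n] fun u => (Real.exp (-‖u‖ ^ 2) : ℂ))) z

/-- The bivariate complex Hermite polynomial, for `M = (m, n, m', n')`,
`H_M(z, w) = H_{m,n}(z + iw, z̄ - iw̄) H_{m',n'}(z̄ + iw̄, z - iw)`. -/
def bivHermite (M : Fin 4 → ℕ) (p : ℂ × ℂ) : ℂ :=
  univHermite (M 0) (M 1) (p.1 + I * p.2) * univHermite (M 2) (M 3) (conj p.1 + I * conj p.2)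

/-! ### The Hilbert space -/

/-- The measure `e^{-2(|z|² + |w|²)} dλ(z, w)` on `ℂ²`, with `dλ` the Lebesgue measure. -/
def gaussMeasure : Measure (ℂ × ℂ) :=
  (volume : Measure (ℂ × ℂ)).withDensity
    fun p => ENNReal.ofReal (Real.exp (-2 * (‖p.1‖ ^ 2 + ‖p.2‖ ^ 2)))

lemma continuous_weight :
    Continuous fun p : ℂ × ℂ => Real.exp (-2 * (‖p.1‖ ^ 2 + ‖p.2‖ ^ 2)) := by
  fun_prop

instance : IsLocallyFiniteMeasure gaussMeasure :=
  IsLocallyFiniteMeasure.withDensity_ofReal continuous_weight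

instance : gaussMeasure.IsOpenPosMeasure := by
  have h : (volume : Measure (ℂ × ℂ)) ≪ gaussMeasure := by
    refine withDensity_absolutelyContinuous' ?_ ?_
    · exact (ENNReal.measurable_ofReal.comp continuous_weight.measurable).aemeasurable
    · refine Filter.Eventually.of_forall fun p => ?_
      simpa using Real.exp_pos _
  exact h.isOpenPosMeasure

/-- The Hilbert space `L²(ℂ², e^{-2(|z|² + |w|²)} dλ)`. -/
abbrev GaussL2 : Type := Lp ℂ 2 gaussMeasure

/-! ### Differential operators with smooth coefficients on `ℂ²` -/

/-- The space of (real-)smooth functions `ℂ² → ℂ`. -/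
def Smooth : Submodule ℂ (ℂ × ℂ → ℂ) where
  carrier := {f | ContDiff ℝ ∞ f}
  add_mem' {f g} hf hg := by
    simp only [Set.mem_ofPred_eq] at hf hg ⊢
    exact hf.add hg
  zero_mem' := by
    simp only [Set.mem_ofPred_eq]
    exact contDiff_const
  smul_mem' c f hf := by
    simp only [Set.mem_ofPred_eq] at hf ⊢
    exact hf.const_smul c

lemma contDiff_smooth (f : Smooth) : ContDiff ℝ ∞ (f : ℂ × ℂ → ℂ) := f.2

lemma differentiable_smooth (f : Smooth) : Differentiable ℝ (f : ℂ × ℂ → ℂ) :=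
  (contDiff_smooth f).differentiable (by simp)

/-- The derivative in the real direction `v` of `ℂ² = ℝ⁴`. -/
def dir (v : ℂ × ℂ) : Module.End ℂ Smooth where
  toFun f := ⟨fun p => fderiv ℝ (f : ℂ × ℂ → ℂ) p v,
    ((contDiff_smooth f).fderiv_right (m := ∞) (by simp)).clm_apply contDiff_const⟩
  map_add' f g := by
    ext p
    simp [fderiv_add (differentiable_smooth f).differentiableAt (differentiable_smooth g).differentiableAt]
  map_smul' c f := by
    ext p
    simp [fderiv_const_smul (differentiable_smooth f).differentiableAt]

/-- Multiplication by the smooth function `a`. -/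
def mulBy (a : Smooth) : Module.End ℂ Smooth where
  toFun f := ⟨fun p => a.1 p * f.1 p, (contDiff_smooth a).mul (contDiff_smooth f)⟩
  map_add' f g := by ext p; simp [mul_add]
  map_smul' c f := by ext p; simp [mul_left_comm]

/-- The complex conjugate of a smooth function. -/
def conjFn (f : Smooth) : Smooth :=
  ⟨fun p => conj (f.1 p), Complex.conjCLE.contDiff.comp (contDiff_smooth f)⟩

/-- The complex conjugate `f ↦ conj (P (conj f))` of the operator `P`. -/
def conjOp (P : Module.End ℂ Smooth) : Module.End ℂ Smooth where
  toFun f := conjFn (P (conjFn f))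
  map_add' f g := by
    have h : conjFn (f + g) = conjFn f + conjFn g := by ext p; simp [conjFn]
    rw [h, map_add]
    ext p; simp [conjFn]
  map_smul' c f := by
    have h : conjFn (c • f) = conj c • conjFn f := by ext p; simp [conjFn]
    rw [h, map_smul]
    ext p; simp [conjFn]

/-- `∂/∂z` -/
def dz : Module.End ℂ Smooth := (1 / 2 : ℂ) • (dir (1, 0) - I • dir (I, 0))
/-- `∂/∂z̄` -/
def dzBar : Module.End ℂ Smooth := (1 / 2 : ℂ) • (dir (1, 0) + I • dir (I, 0))
/-- `∂/∂w` -/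
def dw : Module.End ℂ Smooth := (1 / 2 : ℂ) • (dir (0, 1) - I • dir (0, I))
/-- `∂/∂w̄` -/
def dwBar : Module.End ℂ Smooth := (1 / 2 : ℂ) • (dir (0, 1) + I • dir (0, I))

/-- The coordinate function `z`. -/
def zFn : Smooth := ⟨fun p => p.1, (contDiff_fst : ContDiff ℝ ∞ fun p : ℂ × ℂ => p.1)⟩
/-- The coordinate function `w`. -/
def wFn : Smooth := ⟨fun p => p.2, (contDiff_snd : ContDiff ℝ ∞ fun p : ℂ × ℂ => p.2)⟩

/-- `Δ = ∂²/∂z∂z̄ + ∂²/∂w∂w̄` -/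
def laplace : Module.End ℂ Smooth := dz * dzBar + dw * dwBar

/-- `□ = ∂²/∂z∂w̄ - ∂²/∂w∂z̄` -/
def box : Module.End ℂ Smooth := dz * dwBar - dw * dzBar

/-- `S_ξ = -¼ (Δ + i□ - 2(z ∂/∂z + w ∂/∂w) + 2i(z ∂/∂w - w ∂/∂z))` -/
def Sxi : Module.End ℂ Smooth :=
  (-(1 / 4) : ℂ) • (laplace + I • box - (2 : ℂ) • (mulBy zFn * dz + mulBy wFn * dw)
    + (2 * I) • (mulBy zFn * dw - mulBy wFn * dz))

/-- `S_{ξ*} = -¼ (Δ - i□ - 2(z̄ ∂/∂z̄ + w̄ ∂/∂w̄) + 2i(z̄ ∂/∂w̄ - w̄ ∂/∂z̄))` -/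
def SxiStar : Module.End ℂ Smooth :=
  (-(1 / 4) : ℂ) • (laplace - I • box
    - (2 : ℂ) • (mulBy (conjFn zFn) * dzBar + mulBy (conjFn wFn) * dwBar)
    + (2 * I) • (mulBy (conjFn zFn) * dwBar - mulBy (conjFn wFn) * dzBar))

/-- The four operators `S_ξ`, `S_{ξ̄}`, `S_{ξ*}`, `S_{ξ̃}`, in this order; the second and the
fourth are the complex conjugates of the first and the third. -/
def S : Fin 4 → Module.End ℂ Smooth := ![Sxi, conjOp Sxi, SxiStar, conjOp SxiStar]

/-- The functions `ξ = z + iw`, `ξ̄ = z̄ - iw̄`, `ξ* = z̄ + iw̄`, `ξ̃ = z - iw`, in this order. -/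
def xi : Fin 4 → Smooth :=
  ![zFn + I • wFn, conjFn zFn - I • conjFn wFn, conjFn zFn + I • conjFn wFn, zFn - I • wFn]

/-- The operators `A_ξ`, `A_{ξ̄}`, `A_{ξ*}`, `A_{ξ̃}`, in this order. -/
def A : Fin 4 → Module.End ℂ Smooth :=
  ![(1 / 2 : ℂ) • (dz - I • dw), (1 / 2 : ℂ) • (dzBar + I • dwBar),
    (1 / 2 : ℂ) • (dzBar - I • dwBar), (1 / 2 : ℂ) • (dz + I • dw)]

/-- `ξA_ξ - A_ξA_{ξ̄}`, `ξ̄A_{ξ̄} - A_ξA_{ξ̄}`, `ξ*A_{ξ*} - A_{ξ*}A_{ξ̃}`,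
`ξ̃A_{ξ̃} - A_{ξ*}A_{ξ̃}`, in this order. -/
def L : Fin 4 → Module.End ℂ Smooth :=
  ![mulBy (xi 0) * A 0 - A 0 * A 1, mulBy (xi 1) * A 1 - A 0 * A 1,
    mulBy (xi 2) * A 2 - A 2 * A 3, mulBy (xi 3) * A 3 - A 2 * A 3]

/-! ### The operators in the Hilbert space -/

/-- The space `C_c^∞(ℂ²)`. -/
def TestFn : Submodule ℂ Smooth where
  carrier := {f | HasCompactSupport (f : ℂ × ℂ → ℂ)}
  add_mem' hf hg := HasCompactSupport.add hf hg
  zero_mem' := HasCompactSupport.zero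
  smul_mem' _ f hf := HasCompactSupport.smul_left (f' := (f : ℂ × ℂ → ℂ)) hf

/-- The operator `P` maps `C_c^∞(ℂ²)` to itself. -/
def PreservesTest (P : Module.End ℂ Smooth) : Prop := ∀ f ∈ TestFn, P f ∈ TestFn

namespace PreservesTest

variable {P Q : Module.End ℂ Smooth}

lemma add (hP : PreservesTest P) (hQ : PreservesTest Q) : PreservesTest (P + Q) :=
  fun f hf => TestFn.add_mem (hP f hf) (hQ f hf)

lemma sub (hP : PreservesTest P) (hQ : PreservesTest Q) : PreservesTest (P - Q) :=
  fun f hf => TestFn.sub_mem (hP f hf) (hQ f hf)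

lemma smul (c : ℂ) (hP : PreservesTest P) : PreservesTest (c • P) :=
  fun f hf => TestFn.smul_mem c (hP f hf)

lemma mul (hP : PreservesTest P) (hQ : PreservesTest Q) : PreservesTest (P * Q) :=
  fun f hf => hP _ (hQ f hf)

lemma mulBy (a : Smooth) : PreservesTest (mulBy a) :=
  fun _ hf => HasCompactSupport.mul_left hf

lemma dir (v : ℂ × ℂ) : PreservesTest (dir v) :=
  fun _ hf => HasCompactSupport.fderiv_apply ℝ hf v

lemma conjFn {f : Smooth} (hf : f ∈ TestFn) : conjFn f ∈ TestFn :=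
  HasCompactSupport.comp_left (g := fun c : ℂ => conj c) hf (map_zero _)

lemma conjOp (hP : PreservesTest P) : PreservesTest (conjOp P) :=
  fun _ hf => conjFn (hP _ (conjFn hf))

lemma dz : PreservesTest dz := ((dir _).sub ((dir _).smul _)).smul _
lemma dzBar : PreservesTest dzBar := ((dir _).add ((dir _).smul _)).smul _
lemma dw : PreservesTest dw := ((dir _).sub ((dir _).smul _)).smul _
lemma dwBar : PreservesTest dwBar := ((dir _).add ((dir _).smul _)).smul _

lemma laplace : PreservesTest laplace := (dz.mul dzBar).add (dw.mul dwBar)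
lemma box : PreservesTest box := (dz.mul dwBar).sub (dw.mul dzBar)

lemma Sxi : PreservesTest Sxi :=
  (((laplace.add (box.smul _)).sub ((((mulBy _).mul dz).add ((mulBy _).mul dw)).smul _)).add
    ((((mulBy _).mul dw).sub ((mulBy _).mul dz)).smul _)).smul _

lemma SxiStar : PreservesTest SxiStar :=
  (((laplace.sub (box.smul _)).sub ((((mulBy _).mul dzBar).add ((mulBy _).mul dwBar)).smul _)).add
    ((((mulBy _).mul dwBar).sub ((mulBy _).mul dzBar)).smul _)).smul _

end PreservesTest

lemma S_preservesTest (j : Fin 4) : PreservesTest (S j) := by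
  fin_cases j
  exacts [PreservesTest.Sxi, PreservesTest.Sxi.conjOp, PreservesTest.SxiStar,
    PreservesTest.SxiStar.conjOp]

lemma memLp_test (f : TestFn) : MemLp (f : ℂ × ℂ → ℂ) 2 gaussMeasure :=
  (contDiff_smooth f.1).continuous.memLp_of_hasCompactSupport f.2

/-- The map sending a test function to its class in the Hilbert space. -/
def toL2 : TestFn →ₗ[ℂ] GaussL2 where
  toFun f := (memLp_test f).toLp _
  map_add' f g := MemLp.toLp_add (memLp_test f) (memLp_test g)
  map_smul' c f := MemLp.toLp_const_smul c (memLp_test f)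

lemma toL2_injective : Function.Injective toL2 := by
  intro f g h
  have h' := (MemLp.toLp_eq_toLp_iff (memLp_test f) (memLp_test g)).1 h
  have := ((contDiff_smooth f.1).continuous.ae_eq_iff_eq gaussMeasure (contDiff_smooth g.1).continuous).1 h'
  exact Subtype.ext (Subtype.ext this)

/-- `S j` as an unbounded operator in the Hilbert space with domain `C_c^∞(ℂ²)`. -/
def minimalOp (j : Fin 4) : GaussL2 →ₗ.[ℂ] GaussL2 where
  domain := LinearMap.range toL2
  toFun := toL2 ∘ₗ (S j).restrict (S_preservesTest j) ∘ₗ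
    (LinearEquiv.ofInjective toL2 toL2_injective).symm.toLinearMap

/-- `S j` as an operator acting on the Hilbert space: the closure of its restriction
to `C_c^∞(ℂ²)`. -/
def realization (j : Fin 4) : GaussL2 →ₗ.[ℂ] GaussL2 := (minimalOp j).closure

/-! ### Spectral theory of unbounded operators -/

section Spectral

variable {E : Type*} [NormedAddCommGroup E] [NormedSpace ℂ E]

/-- The resolvent set of the unbounded operator `T`: the `μ` for which `T - μ` is a bijection from
the domain of `T` onto the space, with bounded inverse. -/
def resolventSet (T : E →ₗ.[ℂ] E) : Set ℂ :=
  {μ | ∃ R : E →L[ℂ] E, (∀ x : T.domain, R (T x - μ • (x : E)) = x) ∧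
    ∀ y : E, ∃ x : T.domain, (x : E) = R y ∧ T x - μ • (x : E) = y}

/-- The spectrum of the unbounded operator `T`. -/
def spectrum (T : E →ₗ.[ℂ] E) : Set ℂ := (resolventSet T)ᶜ

/-- The eigenspace `{x ∈ dom T | T x = μ x}`. -/
def eigenspace (T : E →ₗ.[ℂ] E) (μ : ℂ) : Submodule ℂ E :=
  T.graph.comap (LinearMap.id.prod (μ • LinearMap.id))

lemma mem_eigenspace_iff (T : E →ₗ.[ℂ] E) (μ : ℂ) (x : E) :
    x ∈ eigenspace T μ ↔ ∃ y : T.domain, (y : E) = x ∧ T y = μ • x := by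
  simp only [eigenspace, Submodule.mem_comap, LinearPMap.mem_graph_iff]
  rfl

/-- The spectrum of `T` is a closed set of isolated points, each of them is an eigenvalue, and the
eigenvectors span a dense subspace. Multiplicities may be infinite. -/
def HasPurelyDiscreteSpectrum (T : E →ₗ.[ℂ] E) : Prop :=
  IsClosed (spectrum T) ∧ IsDiscrete (spectrum T) ∧
    (∀ μ ∈ spectrum T, eigenspace T μ ≠ ⊥) ∧
    (⨆ μ : ℂ, eigenspace T μ).topologicalClosure = ⊤

end Spectral

end BivariateHermite

end

/-! In the coordinates ξ, ξ̄, ξ*, ξ̃ the problem separates: `A j` is differentiation in the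
coordinate `xi j` (`A_xi`), and by the parallelogram law the weight is exp(-(ξξ̄ + ξ*ξ̃)). Each `S
j` becomes an Ornstein–Uhlenbeck operator `L j` in one conjugate pair of coordinates (`S_eq_L`),
with `bar` exchanging the members of the pair.

Three facts about `L j` are needed. Eigenvectors: on Hermite polynomials `A j` lowers the j-th
index, while multiplication by `xi j` raises it, up to a term lowering the conjugate index; in `L j`
those extra terms cancel, so H_M has eigenvalue M_j (`L_hermM`). Cutoffs put H_M in the domain of
the closure (`exists_tendsto_test`). Symmetry on test functions: this is Green's formula
(`integral_L_mul`), because `A (bar j)` of the weight is -ξ_j times the weight. Completeness: a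
function orthogonal to every H_M is orthogonal to all powers of real linear forms. By exponential
integrability its Fourier transform against the Gaussian measure vanishes, so the function is zero
(`span_hermL2_dense`).

The rest is abstract (`IsDiagonal`). For a closed symmetric operator T with a complete system of
eigenvectors for natural eigenvalues, the space is the Hilbert sum of the closed spans of
eigenvectors, and T multiplies the l-th coordinate by l. Hence T - μ is bounded below by the
distance from μ to ℕ. For μ outside ℕ its range is dense, as it contains every eigenvector, so μ
lies in the resolvent set. Taking μ = ±i gives self-adjointness, and comparing coordinates
identifies the eigenspaces. -/

noncomputable section

namespace BivariateHermite

/-! ### Operators with a complete system of eigenvectors -/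

section Diagonal

variable {E : Type*} [NormedAddCommGroup E] [InnerProductSpace ℂ E]

/-- `T - μ` as a continuous map on the graph of `T`. -/
def graphSub (T : E →ₗ.[ℂ] E) (μ : ℂ) : T.graph →L[ℂ] E :=
  (ContinuousLinearMap.snd ℂ E E - μ • ContinuousLinearMap.fst ℂ E E) ∘L T.graph.subtypeL

lemma graphSub_apply (T : E →ₗ.[ℂ] E) (μ : ℂ) (x : T.graph) :
    graphSub T μ x = x.1.2 - μ • x.1.1 := rfl

lemma mem_eigenspace_iff_mem_graph (T : E →ₗ.[ℂ] E) (μ : ℂ) (x : E) :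
    x ∈ eigenspace T μ ↔ (x, μ • x) ∈ T.graph := Iff.rfl

/-- The natural numbers form a closed discrete subset of `ℂ`. -/
lemma isClosedEmbedding_natCast : Topology.IsClosedEmbedding (fun l : ℕ => (l : ℂ)) := by
  have h : Topology.IsClosedEmbedding ((↑) : ℝ → ℂ) :=
    Complex.isometry_ofReal.isClosedEmbedding
  have h2 := h.comp Nat.isClosedEmbedding_coe_real
  have h3 : ((↑) : ℝ → ℂ) ∘ ((↑) : ℕ → ℝ) = fun l : ℕ => (l : ℂ) := by ext; simp
  rwa [h3] at h2

variable {T : E →ₗ.[ℂ] E}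

/-- If `T` is closed and `T - μ` is bounded below with dense range, then `μ` is in the resolvent
set. -/
lemma mem_resolventSet_of_bound [CompleteSpace E] (hT : T.IsClosed) {μ : ℂ} {d : ℝ} (hd : 0 < d)
    (hb : ∀ x : T.graph, d * ‖x.1.1‖ ≤ ‖graphSub T μ x‖)
    (hr : Dense (Set.range (graphSub T μ))) : μ ∈ resolventSet T := by
  -- Closedness of T makes its graph a Banach space, so T - μ can be treated as a bounded operator
  -- on the graph.
  have : CompleteSpace T.graph := hT.completeSpace_coe
  -- The graph carries the sup norm; K dominates both 1/d, which bounds x, and 1 + ‖μ‖/d, which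
  -- bounds T x.
  set K : ℝ := 1 + (1 + ‖μ‖) / d with hK
  have hK0 : 0 ≤ K := by positivity
  have hbound : ∀ x : T.graph, ‖x‖ ≤ (⟨K, hK0⟩ : NNReal) * ‖graphSub T μ x‖ := by
    intro x
    have h1 : ‖x.1.1‖ ≤ (1 / d) * ‖graphSub T μ x‖ := by
      rw [one_div, ← div_eq_inv_mul, le_div_iff₀ hd, mul_comm]
      exact hb x
    have h2 : ‖x.1.2‖ ≤ ‖graphSub T μ x‖ + ‖μ‖ * ‖x.1.1‖ := by
      have : x.1.2 = graphSub T μ x + μ • x.1.1 := by simp [graphSub_apply]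
      calc ‖x.1.2‖ = ‖graphSub T μ x + μ • x.1.1‖ := by rw [← this]
        _ ≤ _ := (norm_add_le _ _).trans (by rw [norm_smul])
    have h3 : ‖x‖ = max ‖x.1.1‖ ‖x.1.2‖ := rfl
    have h4 := norm_nonneg (graphSub T μ x)
    change ‖x‖ ≤ K * _
    rw [h3, hK]
    have h5 : ‖μ‖ * ‖x.1.1‖ ≤ ‖μ‖ * ((1 / d) * ‖graphSub T μ x‖) := by gcongr
    have h6 : (1 + (1 + ‖μ‖) / d) * ‖graphSub T μ x‖ =
      ‖graphSub T μ x‖ + (1 / d) * ‖graphSub T μ x‖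
        + ‖μ‖ * ((1 / d) * ‖graphSub T μ x‖) := by ring
    rw [h6]
    have h7 : 0 ≤ ‖μ‖ * ((1 / d) * ‖graphSub T μ x‖) := by positivity
    have h8 : 0 ≤ (1 / d) * ‖graphSub T μ x‖ := by positivity
    exact max_le (by linarith) (by linarith)
  have hanti := AddMonoidHomClass.antilipschitz_of_bound (graphSub T μ) hbound
  have hcl := hanti.isClosed_range (graphSub T μ).uniformContinuous
  have hsurj : Set.range (graphSub T μ) = Set.univ := hcl.closure_eq ▸ hr.closure_eq
  let e := ContinuousLinearEquiv.ofBijective (graphSub T μ)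
    (LinearMap.ker_eq_bot.2 hanti.injective)
    (LinearMap.range_eq_top.2 (Set.range_eq_univ.1 hsurj))
  have he : ∀ x, e x = graphSub T μ x := fun _ => rfl
  refine ⟨ContinuousLinearMap.fst ℂ E E ∘L T.graph.subtypeL ∘L e.symm.toContinuousLinearMap,
    fun x => ?_, fun y => ?_⟩
  · have h : e.symm (T x - μ • (x : E)) = ⟨((x : E), T x), T.mem_graph x⟩ := by
      rw [ContinuousLinearEquiv.symm_apply_eq, he, graphSub_apply]
    simp [h]
  · obtain ⟨x, hx1, hx2⟩ := (T.mem_graph_iff).1 (e.symm y).2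
    refine ⟨x, hx1, ?_⟩
    rw [hx2, hx1, ← graphSub_apply, ← he, ContinuousLinearEquiv.apply_symm_apply]

/-- `T - μ` is onto for `μ` in the resolvent set. -/
lemma exists_graph_of_mem_resolventSet {μ : ℂ} (h : μ ∈ resolventSet T) (y : E) :
    ∃ x : T.domain, T x - μ • (x : E) = y := by
  obtain ⟨R, -, hR⟩ := h
  obtain ⟨x, -, hx⟩ := hR y
  exact ⟨x, hx⟩

/-- A densely defined symmetric operator for which `T - i` and `T + i` are onto is self-adjoint. -/
lemma isSelfAdjoint_of_resolvent [CompleteSpace E] (hd : Dense (T.domain : Set E)) (hs : T.IsFormalAdjoint T)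
    (h1 : I ∈ resolventSet T) (h2 : -I ∈ resolventSet T) : IsSelfAdjoint T := by
  rw [LinearPMap.isSelfAdjoint_def]
  have hle : T ≤ T.adjoint := LinearPMap.IsFormalAdjoint.le_adjoint hd hs
  refine (LinearPMap.eq_of_le_of_domain_eq hle (le_antisymm hle.1 fun y hy => ?_)).symm
  -- With (T - i)x = (T* - i)y, the difference y - x lies in ker(T* - i), the orthogonal complement
  -- of the range of T + i. That range is everything, so y = x is in the domain of T.
  obtain ⟨x, hx⟩ := exists_graph_of_mem_resolventSet h1 (T.adjoint ⟨y, hy⟩ - I • y)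
  have hyx : y - x = 0 := by
    obtain ⟨z, hz⟩ := exists_graph_of_mem_resolventSet h2 (y - x)
    rw [← inner_self_eq_zero (𝕜 := ℂ)]
    nth_rewrite 1 [← hz]
    have e1 : inner ℂ (T z) y = inner ℂ (z : E) (T.adjoint ⟨y, hy⟩) :=
      (LinearPMap.adjoint_isFormalAdjoint hd).symm z ⟨y, hy⟩
    have e2 : inner ℂ (T z) (x : E) = inner ℂ (z : E) (T x) := hs z x
    have e3 : T x = T.adjoint ⟨y, hy⟩ - I • y + I • (x : E) := by rw [← hx]; simp
    simp only [inner_sub_left, inner_sub_right, inner_smul_left, e1, e2, e3, inner_add_right,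
      inner_smul_right, map_neg, conj_I]
    ring
  rw [sub_eq_zero.1 hyx]
  exact x.2

/-- Eigenspaces of a closed operator are closed. -/
lemma isClosed_eigenspace (hT : T.IsClosed) (μ : ℂ) : IsClosed (eigenspace T μ : Set E) :=
  hT.preimage (f := fun x : E => (x, μ • x)) (by fun_prop)

/-- Symmetry in terms of eigenvectors and the graph. -/
lemma inner_eigenvector (hs : T.IsFormalAdjoint T) {l : ℕ} {v : E}
    (hv : v ∈ eigenspace T l) {x : E × E} (hx : x ∈ T.graph) :
    inner ℂ v x.2 = (l : ℂ) * inner ℂ v x.1 := by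
  obtain ⟨a, ha1, ha2⟩ := (T.mem_graph_iff).1 hx
  obtain ⟨b, hb1, hb2⟩ := (mem_eigenspace_iff T l v).1 hv
  rw [← ha2, ← ha1, ← hb1, ← hs b a, hb2, ← hb1, inner_smul_left]
  simp

/-- The spectral theory of a closed symmetric operator with a complete system of eigenvectors
`e M` for the natural eigenvalues `deg M`. -/
structure IsDiagonal (T : E →ₗ.[ℂ] E) {ι : Type*} (e : ι → E) (deg : ι → ℕ) : Prop where
  isClosed : T.IsClosed
  symm : T.IsFormalAdjoint T
  mem_eigenspace : ∀ M, e M ∈ eigenspace T (deg M)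
  ne_zero : ∀ M, e M ≠ 0
  dense : (Submodule.span ℂ (Set.range e)).topologicalClosure = ⊤

namespace IsDiagonal

variable {ι : Type*} {e : ι → E} {deg : ι → ℕ}

/-- The closed span of the given eigenvectors for the eigenvalue `l`. -/
def part (e : ι → E) (deg : ι → ℕ) (l : ℕ) : Submodule ℂ E :=
  (Submodule.span ℂ {u | ∃ M, deg M = l ∧ u = e M}).topologicalClosure

instance [CompleteSpace E] (l : ℕ) : CompleteSpace (part e deg l) :=
  (Submodule.isClosed_topologicalClosure _).completeSpace_coe

lemma part_le (h : IsDiagonal T e deg) (l : ℕ) : part e deg l ≤ eigenspace T l := by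
  refine Submodule.topologicalClosure_minimal _ (Submodule.span_le.2 ?_)
    (isClosed_eigenspace h.isClosed _)
  rintro _ ⟨M, rfl, rfl⟩
  exact h.mem_eigenspace M

lemma mem_part (M : ι) : e M ∈ part e deg (deg M) :=
  Submodule.le_topologicalClosure _ (Submodule.subset_span ⟨M, rfl, rfl⟩)

lemma isHilbertSum [CompleteSpace E] (h : IsDiagonal T e deg) :
    IsHilbertSum ℂ (fun l => part e deg l) fun l => (part e deg l).subtypeₗᵢ := by
  refine IsHilbertSum.mkInternal _ ?_ ?_
  · intro k l hkl v w
    have hv := h.part_le k v.2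
    have hw := h.part_le l w.2
    -- Symmetry makes eigenvectors for different eigenvalues orthogonal: k⟨v, w⟩ = l⟨v, w⟩.
    have := inner_eigenvector h.symm hv (x := ((w : E), (l : ℂ) • (w : E))) hw
    rw [inner_smul_right] at this
    have h2 : ((l : ℂ) - k) * inner ℂ (v : E) (w : E) = 0 := by linear_combination this
    rcases mul_eq_zero.1 h2 with h3 | h3
    · exact absurd (Nat.cast_injective (sub_eq_zero.1 h3)) (Ne.symm hkl)
    · exact h3
  · rw [← h.dense]
    refine Submodule.topologicalClosure_mono (Submodule.span_le.2 ?_)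
    rintro _ ⟨M, rfl⟩
    exact (le_iSup (part e deg) (deg M)) (mem_part M)

/-- The coordinates with respect to the eigenspace decomposition. -/
def coords [CompleteSpace E] (h : IsDiagonal T e deg) : E ≃ₗᵢ[ℂ] lp (fun l => part e deg l) 2 :=
  h.isHilbertSum.linearIsometryEquiv

lemma inner_coords [CompleteSpace E] (h : IsDiagonal T e deg) {l : ℕ} (v : part e deg l) (x : E) :
    inner ℂ v (h.coords x l) = inner ℂ (v : E) x := by
  have h1 := lp.inner_single_left (𝕜 := ℂ) (G := fun l => part e deg l) l v (h.coords x)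
  have h2 : h.coords.symm (lp.single 2 l v) = (v : E) :=
    h.isHilbertSum.linearIsometryEquiv_symm_apply_single v
  refine h1.symm.trans ?_
  rw [← h.coords.symm.inner_map_map, h.coords.symm_apply_apply, h2]

/-- Testing against eigenvectors v moves T onto v, so T is diagonal on its whole domain without
expanding T x as a series. -/
lemma coords_graph [CompleteSpace E] (h : IsDiagonal T e deg) (x : T.graph) (l : ℕ) :
    h.coords x.1.2 l = (l : ℂ) • h.coords x.1.1 l := by
  refine ext_inner_left ℂ fun v => ?_
  rw [inner_smul_right, h.inner_coords, h.inner_coords]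
  exact inner_eigenvector h.symm (h.part_le l v.2) x.2

lemma coords_graphSub [CompleteSpace E] (h : IsDiagonal T e deg) (x : T.graph) (μ : ℂ) (l : ℕ) :
    h.coords (graphSub T μ x) l = ((l : ℂ) - μ) • h.coords x.1.1 l := by
  rw [graphSub_apply, map_sub, map_smul, lp.coeFn_sub, Pi.sub_apply, h.coords_graph, sub_smul]
  rfl

lemma bound [CompleteSpace E] (h : IsDiagonal T e deg) {μ : ℂ} {d : ℝ} (hd : 0 ≤ d)
    (hμ : ∀ l : ℕ, d ≤ ‖(l : ℂ) - μ‖) (x : T.graph) : d * ‖x.1.1‖ ≤ ‖graphSub T μ x‖ := by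
  rw [← h.coords.norm_map x.1.1, ← h.coords.norm_map (graphSub T μ x)]
  have : d * ‖h.coords x.1.1‖ = ‖(d : ℂ) • h.coords x.1.1‖ := by
    rw [norm_smul, Complex.norm_real, Real.norm_of_nonneg hd]
  rw [this]
  refine lp.norm_mono (by simp) fun l => ?_
  rw [h.coords_graphSub, lp.coeFn_smul, Pi.smul_apply, norm_smul, norm_smul, Complex.norm_real,
    Real.norm_of_nonneg hd]
  gcongr
  exact hμ l

/-- Each eigenvector is itself in the range: e M is the image of (deg M - μ)⁻¹ e M. -/
lemma dense_range_graphSub (h : IsDiagonal T e deg) {μ : ℂ} (hμ : ∀ l : ℕ, (l : ℂ) ≠ μ) :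
    Dense (Set.range (graphSub T μ)) := by
  have hle : Submodule.span ℂ (Set.range e) ≤ LinearMap.range (graphSub T μ).toLinearMap := by
    refine Submodule.span_le.2 ?_
    rintro _ ⟨M, rfl⟩
    have h1 : ((deg M : ℂ) - μ) ≠ 0 := sub_ne_zero.2 (hμ _)
    refine ⟨((deg M : ℂ) - μ)⁻¹ • ⟨(e M, (deg M : ℂ) • e M), h.mem_eigenspace M⟩, ?_⟩
    rw [map_smul]
    change _ • graphSub T μ _ = _
    rw [graphSub_apply]
    simp only [← sub_smul]
    rw [smul_smul, inv_mul_cancel₀ h1, one_smul]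
  have hd : Dense (Submodule.span ℂ (Set.range e) : Set E) :=
    (Submodule.dense_iff_topologicalClosure_eq_top).2 h.dense
  exact hd.mono hle

lemma mem_resolventSet [CompleteSpace E] (h : IsDiagonal T e deg) {μ : ℂ} (hμ : ∀ l : ℕ, (l : ℂ) ≠ μ) :
    μ ∈ resolventSet T := by
  have hcl := isClosedEmbedding_natCast.isClosed_range
  -- Since ℕ is closed in ℂ, the distance from μ to ℕ is a positive lower bound for all |l - μ|.
  have hpos : 0 < Metric.infDist μ (Set.range fun l : ℕ => (l : ℂ)) :=
    (hcl.notMem_iff_infDist_pos ⟨0, 0, by simp⟩).1 (by rintro ⟨l, hl⟩; exact hμ l hl)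
  refine mem_resolventSet_of_bound h.isClosed hpos
    (h.bound hpos.le fun l => ?_) (h.dense_range_graphSub hμ)
  rw [← dist_eq_norm, dist_comm]
  exact Metric.infDist_le_dist_of_mem ⟨l, rfl⟩

lemma dense_domain (h : IsDiagonal T e deg) : Dense (T.domain : Set E) := by
  have hd : Dense (Submodule.span ℂ (Set.range e) : Set E) :=
    (Submodule.dense_iff_topologicalClosure_eq_top).2 h.dense
  refine hd.mono (Submodule.span_le.2 ?_)
  rintro _ ⟨M, rfl⟩
  exact LinearPMap.mem_domain_of_mem_graph (h.mem_eigenspace M)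

lemma isSelfAdjoint [CompleteSpace E] (h : IsDiagonal T e deg) : IsSelfAdjoint T := by
  refine isSelfAdjoint_of_resolvent h.dense_domain h.symm (h.mem_resolventSet fun l hl => ?_)
    (h.mem_resolventSet fun l hl => ?_) <;> simpa using congrArg Complex.im hl

lemma eigenspace_eq [CompleteSpace E] (h : IsDiagonal T e deg) (l : ℕ) : eigenspace T l = part e deg l := by
  refine le_antisymm (fun x hx => ?_) (h.part_le l)
  -- The k-th coordinate of x is multiplied by k as well as by l, so only the l-th survives.
  have hz : ∀ k : ℕ, k ≠ l → h.coords x k = 0 := by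
    intro k hk
    have h1 := h.coords_graph ⟨(x, (l : ℂ) • x), hx⟩ k
    simp only [map_smul, lp.coeFn_smul, Pi.smul_apply] at h1
    rw [← sub_eq_zero, ← sub_smul] at h1
    exact (smul_eq_zero.1 h1).resolve_left
      (sub_ne_zero.2 fun h2 => hk (Nat.cast_injective h2).symm)
  have hx : h.coords x = lp.single 2 l (h.coords x l) := by
    ext k
    by_cases hk : k = l
    · subst hk; simp
    · simp [hz k hk, lp.single_apply, hk]
  rw [← h.coords.symm_apply_apply x, hx]
  have h2 : h.coords.symm (lp.single 2 l (h.coords x l)) = (h.coords x l : E) :=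
    h.isHilbertSum.linearIsometryEquiv_symm_apply_single (h.coords x l)
  exact h2 ▸ (h.coords x l).2

lemma eigenspace_ne_bot (h : IsDiagonal T e deg) (M : ι) : eigenspace T (deg M) ≠ ⊥ :=
  (Submodule.ne_bot_iff _).2 ⟨e M, h.mem_eigenspace M, h.ne_zero M⟩

lemma spectrum_eq [CompleteSpace E] (h : IsDiagonal T e deg) (hdeg : Function.Surjective deg) :
    spectrum T = Set.range (fun l : ℕ => (l : ℂ)) := by
  ext μ
  constructor
  · intro hμ
    by_contra hn
    exact hμ (h.mem_resolventSet fun l hl => hn ⟨l, hl⟩)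
  · rintro ⟨l, rfl⟩ ⟨R, hR, -⟩
    obtain ⟨M, rfl⟩ := hdeg l
    obtain ⟨x, hx1, hx2⟩ := (mem_eigenspace_iff _ _ _).1 (h.mem_eigenspace M)
    have := hR x
    rw [hx2, hx1, sub_self, map_zero] at this
    exact h.ne_zero M this.symm

lemma hasPurelyDiscreteSpectrum [CompleteSpace E] (h : IsDiagonal T e deg) (hdeg : Function.Surjective deg) :
    HasPurelyDiscreteSpectrum T := by
  refine ⟨?_, ?_, ?_, ?_⟩
  · rw [h.spectrum_eq hdeg]
    exact isClosedEmbedding_natCast.isClosed_range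
  · rw [h.spectrum_eq hdeg]
    exact isClosedEmbedding_natCast.isInducing.isDiscrete_range
  · rw [h.spectrum_eq hdeg]
    rintro _ ⟨l, rfl⟩
    obtain ⟨M, rfl⟩ := hdeg l
    exact h.eigenspace_ne_bot M
  · rw [eq_top_iff, ← h.dense]
    refine Submodule.topologicalClosure_mono (Submodule.span_le.2 ?_)
    rintro _ ⟨M, rfl⟩
    exact (le_iSup (eigenspace T) (deg M : ℂ)) (h.mem_eigenspace M)

end IsDiagonal

end Diagonal

/-! ### Algebra of smooth functions and differential operators -/

lemma dir_apply (v : ℂ × ℂ) (f : Smooth) (p : ℂ × ℂ) :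
    (dir v f : ℂ × ℂ → ℂ) p = fderiv ℝ (f : ℂ × ℂ → ℂ) p v := rfl

@[simp] lemma mulBy_apply (a f : Smooth) (p : ℂ × ℂ) :
    (mulBy a f : ℂ × ℂ → ℂ) p = (a : ℂ × ℂ → ℂ) p * (f : ℂ × ℂ → ℂ) p := rfl

@[simp] lemma conjFn_apply (f : Smooth) (p : ℂ × ℂ) :
    (conjFn f : ℂ × ℂ → ℂ) p = conj ((f : ℂ × ℂ → ℂ) p) := rfl

lemma mulBy_comm (f g : Smooth) : mulBy f g = mulBy g f := by
  ext p; simp [mul_comm]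

lemma conjFn_conjFn (f : Smooth) : conjFn (conjFn f) = f := by
  ext p; simp

lemma conjFn_mulBy (f g : Smooth) : conjFn (mulBy f g) = mulBy (conjFn f) (conjFn g) := by
  ext p; simp

lemma conjFn_sub (f g : Smooth) : conjFn (f - g) = conjFn f - conjFn g := by
  ext p; simp

lemma dir_conjFn (v : ℂ × ℂ) (f : Smooth) : dir v (conjFn f) = conjFn (dir v f) := by
  ext p
  have h := Complex.conjCLE.hasFDerivAt.comp p (differentiable_smooth f p).hasFDerivAt
  have h2 : HasFDerivAt (conjFn f : ℂ × ℂ → ℂ) _ p := h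
  rw [dir_apply, h2.fderiv]
  rfl

lemma dir_mulBy (v : ℂ × ℂ) (f g : Smooth) :
    dir v (mulBy f g) = mulBy (dir v f) g + mulBy f (dir v g) := by
  ext p
  have h := (differentiable_smooth f p).hasFDerivAt.mul (differentiable_smooth g p).hasFDerivAt
  have h2 : HasFDerivAt (mulBy f g : ℂ × ℂ → ℂ) _ p := h
  rw [dir_apply, h2.fderiv]
  simp [dir_apply]
  ring

lemma dir_comm (v w : ℂ × ℂ) (f : Smooth) : dir v (dir w f) = dir w (dir v f) := by
  ext p
  have hd : DifferentiableAt ℝ (fderiv ℝ (f : ℂ × ℂ → ℂ)) p :=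
    (((contDiff_smooth f).fderiv_right (m := ∞) (by simp)).differentiable (by simp)) p
  have key : ∀ a b : ℂ × ℂ, (dir a (dir b f) : ℂ × ℂ → ℂ) p
      = fderiv ℝ (fderiv ℝ (f : ℂ × ℂ → ℂ)) p a b := by
    intro a b
    rw [dir_apply]
    have h : HasFDerivAt (dir b f : ℂ × ℂ → ℂ) _ p := hd.hasFDerivAt.clm_apply
      (hasFDerivAt_const b p)
    rw [h.fderiv]
    simp
  rw [key, key]
  exact ((contDiff_smooth f).contDiffAt.isSymmSndFDerivAt (by
    simp only [minSmoothness_of_isRCLikeNormedField]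
    exact WithTop.coe_le_coe.2 (le_top (a := (2 : ℕ∞))))) v w

lemma conjOp_apply (P : Module.End ℂ Smooth) (f : Smooth) :
    conjOp P f = conjFn (P (conjFn f)) := rfl

lemma dzBar_conjFn (f : Smooth) : dzBar (conjFn f) = conjFn (dz f) := by
  ext p; simp [dzBar, dz, dir_conjFn, map_ofNat]; try ring

lemma dz_conjFn (f : Smooth) : dz (conjFn f) = conjFn (dzBar f) := by
  ext p; simp [dzBar, dz, dir_conjFn, map_ofNat]; try ring

lemma dwBar_conjFn (f : Smooth) : dwBar (conjFn f) = conjFn (dw f) := by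
  ext p; simp [dwBar, dw, dir_conjFn, map_ofNat]; try ring

lemma dw_conjFn (f : Smooth) : dw (conjFn f) = conjFn (dwBar f) := by
  ext p; simp [dwBar, dw, dir_conjFn, map_ofNat]; try ring

/-- The index of the conjugate coordinate. -/
def bar : Fin 4 → Fin 4 := ![1, 0, 3, 2]

lemma A_conjFn (j : Fin 4) (f : Smooth) : A j (conjFn f) = conjFn (A (bar j) f) := by
  fin_cases j <;> ext p <;>
    simp [A, bar, dz_conjFn, dzBar_conjFn, dw_conjFn, dwBar_conjFn, map_ofNat] <;> ring

lemma conjFn_xi (j : Fin 4) : conjFn (xi j) = xi (bar j) := by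
  fin_cases j <;> ext p <;> simp [xi, bar, sub_eq_add_neg]

/-- The operator `A j` in terms of directional derivatives. -/
lemma A_eq (j : Fin 4) : ∃ a b c d : ℂ,
    A j = a • dir (1, 0) + b • dir (I, 0) + c • dir (0, 1) + d • dir (0, I) := by
  fin_cases j
  · exact ⟨1 / 4, -I / 4, -I / 4, -1 / 4, by
      ext f p
      simp [A, dz, dw]
      ring_nf; simp only [I_sq]; ring⟩
  · exact ⟨1 / 4, I / 4, I / 4, -1 / 4, by
      ext f p
      simp [A, dzBar, dwBar]
      ring_nf; simp only [I_sq]; ring⟩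
  · exact ⟨1 / 4, I / 4, -I / 4, 1 / 4, by
      ext f p
      simp [A, dzBar, dwBar]
      ring_nf; simp only [I_sq]; ring⟩
  · exact ⟨1 / 4, -I / 4, I / 4, 1 / 4, by
      ext f p
      simp [A, dz, dw]
      ring_nf; simp only [I_sq]; ring⟩

lemma A_mulBy (j : Fin 4) (f g : Smooth) :
    A j (mulBy f g) = mulBy (A j f) g + mulBy f (A j g) := by
  obtain ⟨a, b, c, d, h⟩ := A_eq j
  ext p
  simp only [h, LinearMap.add_apply, LinearMap.smul_apply, dir_mulBy, Submodule.coe_add,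
    Submodule.coe_smul, Pi.add_apply, Pi.smul_apply, mulBy_apply, smul_eq_mul]
  ring

lemma A_comm (j k : Fin 4) (f : Smooth) : A j (A k f) = A k (A j f) := by
  obtain ⟨a, b, c, d, h⟩ := A_eq j
  obtain ⟨a', b', c', d', h'⟩ := A_eq k
  ext p
  simp only [h, h', LinearMap.add_apply, LinearMap.smul_apply, map_add, map_smul,
    Submodule.coe_add, Submodule.coe_smul, Pi.add_apply, Pi.smul_apply, smul_eq_mul]
  simp only [dir_comm (I, 0) (1, 0), dir_comm (0, 1) (1, 0), dir_comm (0, I) (1, 0),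
    dir_comm (0, 1) (I, 0), dir_comm (0, I) (I, 0), dir_comm (0, I) (0, 1)]
  ring

lemma dz_dzBar_comm (f : Smooth) : dz (dzBar f) = dzBar (dz f) := by
  ext p; simp [dz, dzBar, dir_comm (I, 0) (1, 0)]; ring
lemma dw_dwBar_comm (f : Smooth) : dw (dwBar f) = dwBar (dw f) := by
  ext p; simp [dw, dwBar, dir_comm (0, I) (0, 1)]; ring
lemma dz_dwBar_comm (f : Smooth) : dz (dwBar f) = dwBar (dz f) := by
  ext p; simp [dz, dwBar, dir_comm (0, 1) (1, 0),
    dir_comm (0, I) (1, 0), dir_comm (0, 1) (I, 0), dir_comm (0, I) (I, 0)]; ring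
lemma dw_dzBar_comm (f : Smooth) : dw (dzBar f) = dzBar (dw f) := by
  ext p; simp [dw, dzBar, dir_comm (0, 1) (1, 0),
    dir_comm (0, I) (1, 0), dir_comm (0, 1) (I, 0), dir_comm (0, I) (I, 0)]; ring

lemma L_apply (j : Fin 4) (f : Smooth) :
    L j f = mulBy (xi j) (A j f) - A j (A (bar j) f) := by
  fin_cases j
  · rfl
  · exact congrArg (mulBy (xi 1) (A 1 f) - ·) (A_comm 0 1 f)
  · rfl
  · exact congrArg (mulBy (xi 3) (A 3 f) - ·) (A_comm 2 3 f)

lemma Sxi_eq : Sxi = L 0 := by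
  ext f p
  simp [Sxi, L, A, xi, laplace, box]
  ring_nf; simp only [I_sq]; ring

lemma SxiStar_eq : SxiStar = L 2 := by
  ext f p
  -- Unlike `A 0 * A 1`, the product `A 2 * A 3` has the antiholomorphic derivatives on the left,
  -- the opposite order to `laplace` and `box`; hence the commutation lemmas.
  simp [SxiStar, L, A, xi, laplace, box, dz_dzBar_comm, dw_dwBar_comm, dz_dwBar_comm,
    dw_dzBar_comm]
  ring_nf; simp only [I_sq]; ring

lemma conjOp_L (j : Fin 4) : conjOp (L j) = L (bar j) := by
  ext1 f
  rw [conjOp_apply, L_apply, L_apply, conjFn_sub, conjFn_mulBy, conjFn_xi]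
  simp only [A_conjFn, conjFn_conjFn]

theorem S_eq_L (j : Fin 4) : S j = L j := by
  fin_cases j
  · exact Sxi_eq
  · exact (congrArg conjOp Sxi_eq).trans (conjOp_L 0)
  · exact SxiStar_eq
  · exact (congrArg conjOp SxiStar_eq).trans (conjOp_L 2)

/-! ### Complex Hermite polynomials by recursion -/

/-- The two-variable polynomials which give `univHermite` at `(z, z̄)`. -/
def polyHermite (x y : ℂ) : ℕ → ℕ → ℂ
  | 0, n => y ^ n
  | m + 1, n => x * polyHermite x y m n - n * polyHermite x y m (n - 1)

@[simp] lemma polyHermite_zero (x y : ℂ) (n : ℕ) : polyHermite x y 0 n = y ^ n := by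
  simp [polyHermite]

lemma polyHermite_succ (x y : ℂ) (m n : ℕ) :
    polyHermite x y (m + 1) n = x * polyHermite x y m n - n * polyHermite x y m (n - 1) := by
  simp [polyHermite]

lemma mul_polyHermite_left (x y : ℂ) (m n : ℕ) :
    x * polyHermite x y m n = polyHermite x y (m + 1) n + n * polyHermite x y m (n - 1) := by
  rw [polyHermite_succ]; ring

/-- The defining recursion treats x and y asymmetrically; induction on m restores the symmetry.
Truncated subtraction in `m - 1` and `n - 1` is harmless because the coefficient vanishes there. -/
lemma mul_polyHermite_right (x y : ℂ) (m n : ℕ) :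
    y * polyHermite x y m n = polyHermite x y m (n + 1) + m * polyHermite x y (m - 1) n := by
  induction m generalizing n with
  | zero => simp [pow_succ, mul_comm]
  | succ m ih =>
    have e1 : (m : ℂ) * (x * polyHermite x y (m - 1) n - n * polyHermite x y (m - 1) (n - 1))
        = m * polyHermite x y m n := by
      cases m with
      | zero => simp
      | succ k => simp [polyHermite_succ]
    have e2 : (n : ℂ) * (y * polyHermite x y m (n - 1))
        = n * (polyHermite x y m n + m * polyHermite x y (m - 1) (n - 1)) := by
      cases n with
      | zero => simp
      | succ k => rw [ih]; simp
    rw [polyHermite_succ, polyHermite_succ]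
    simp only [Nat.add_sub_cancel, Nat.cast_succ]
    linear_combination x * ih n - e2 + e1

/-- The Appell property: each partial derivative lowers one index. With x and y arbitrary functions,
it serves both Rodrigues' formula on ℂ and the calculus on ℂ². -/
lemma hasFDerivAt_polyHermite {E : Type*} [NormedAddCommGroup E] [NormedSpace ℝ E]
    {x y : E → ℂ} {x' y' : E →L[ℝ] ℂ} {p : E} (hx : HasFDerivAt x x' p)
    (hy : HasFDerivAt y y' p) (m n : ℕ) :
    HasFDerivAt (fun q => polyHermite (x q) (y q) m n)
      ((m * polyHermite (x p) (y p) (m - 1) n) • x'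
        + (n * polyHermite (x p) (y p) m (n - 1)) • y') p := by
  induction m generalizing n with
  | zero =>
    simp only [polyHermite_zero, Nat.cast_zero, zero_mul]
    exact (hy.pow n).congr_fderiv (by ext v; simp)
  | succ m ih =>
    have h := (hx.mul (ih n)).sub ((ih (n - 1)).const_mul (n : ℂ))
    simp only [polyHermite_succ]
    refine h.congr_fderiv ?_
    have e1 : (m : ℂ) * (x p * polyHermite (x p) (y p) (m - 1) n
        - n * polyHermite (x p) (y p) (m - 1) (n - 1)) = m * polyHermite (x p) (y p) m n := by
      cases m with
      | zero => simp
      | succ k => simp [polyHermite_succ]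
    ext v
    simp only [sub_apply, add_apply,
      smul_apply, smul_eq_mul, Nat.add_sub_cancel, Nat.cast_succ]
    cases n with
    | zero =>
      simp only [Nat.cast_zero] at e1 ⊢
      linear_combination x' v * e1
    | succ k =>
      simp only [Nat.add_sub_cancel] at e1 ⊢
      linear_combination x' v * e1

lemma contDiff_polyHermite {E : Type*} [NormedAddCommGroup E] [NormedSpace ℝ E]
    {x y : E → ℂ} (hx : ContDiff ℝ ∞ x) (hy : ContDiff ℝ ∞ y) (m n : ℕ) :
    ContDiff ℝ ∞ fun q => polyHermite (x q) (y q) m n := by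
  induction m generalizing n with
  | zero => simpa using hy.pow n
  | succ m ih =>
    simp only [polyHermite_succ]
    exact (hx.mul (ih n)).sub (contDiff_const.mul (ih (n - 1)))

lemma wirtinger_of_hasFDerivAt {f : ℂ → ℂ} {a b z : ℂ}
    (h : HasFDerivAt f (a • ContinuousLinearMap.id ℝ ℂ + b • (conjCLE : ℂ →L[ℝ] ℂ)) z) :
    wirtinger f z = a := by
  rw [wirtinger, h.fderiv]
  simp
  linear_combination (-(a / 2) + b / 2) * I_mul_I

lemma wirtingerBar_of_hasFDerivAt {f : ℂ → ℂ} {a b z : ℂ}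
    (h : HasFDerivAt f (a • ContinuousLinearMap.id ℝ ℂ + b • (conjCLE : ℂ →L[ℝ] ℂ)) z) :
    wirtingerBar f z = b := by
  rw [wirtingerBar, h.fderiv]
  simp
  linear_combination ((a / 2) - b / 2) * I_mul_I

lemma ofReal_exp_neg_norm_sq (z : ℂ) :
    ((Real.exp (-‖z‖ ^ 2) : ℝ) : ℂ) = cexp (-(z * conj z)) := by
  rw [mul_conj, normSq_eq_norm_sq]; push_cast; rfl

/-- The two coefficients are the Wirtinger derivatives. By the recursion the second is -c H_{m+1,n}
times the Gaussian; for m = 0 the first is -c z̄^{n+1} times it. These are the two induction steps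
in Rodrigues' formula. -/
lemma hasFDerivAt_polyHermite_mul_gauss (c : ℂ) (m n : ℕ) (z : ℂ) :
    HasFDerivAt (fun u : ℂ => c * polyHermite u (conj u) m n * (Real.exp (-‖u‖ ^ 2) : ℂ))
      ((c * (m * polyHermite z (conj z) (m - 1) n - conj z * polyHermite z (conj z) m n)
          * (Real.exp (-‖z‖ ^ 2) : ℂ)) • ContinuousLinearMap.id ℝ ℂ
        + (c * (n * polyHermite z (conj z) m (n - 1) - z * polyHermite z (conj z) m n)
          * (Real.exp (-‖z‖ ^ 2) : ℂ)) • (conjCLE : ℂ →L[ℝ] ℂ)) z := by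
  have h1 : HasFDerivAt (fun u : ℂ => u) (ContinuousLinearMap.id ℝ ℂ) z := hasFDerivAt_id z
  have h2 : HasFDerivAt (fun u : ℂ => conj u) (conjCLE : ℂ →L[ℝ] ℂ) z := conjCLE.hasFDerivAt
  have h3 := (h1.mul h2).neg.cexp
  have h4 := ((hasFDerivAt_polyHermite h1 h2 m n).const_mul c).mul h3
  simp only [ofReal_exp_neg_norm_sq]
  refine h4.congr_fderiv ?_
  ext v
  simp
  ring

lemma iterate_wirtinger_gauss (n : ℕ) :
    (wirtinger^[n] fun u => (Real.exp (-‖u‖ ^ 2) : ℂ)) =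
      fun u => (-1) ^ n * polyHermite u (conj u) 0 n * (Real.exp (-‖u‖ ^ 2) : ℂ) := by
  induction n with
  | zero => simp
  | succ n ih =>
    rw [Function.iterate_succ_apply', ih]
    ext z
    rw [wirtinger_of_hasFDerivAt (hasFDerivAt_polyHermite_mul_gauss _ _ _ _)]
    simp only [polyHermite_zero, pow_succ]
    push_cast
    ring

lemma iterate_wirtingerBar_gauss (m n : ℕ) :
    (wirtingerBar^[m] (wirtinger^[n] fun u => (Real.exp (-‖u‖ ^ 2) : ℂ))) =
      fun u => (-1) ^ (m + n) * polyHermite u (conj u) m n * (Real.exp (-‖u‖ ^ 2) : ℂ) := by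
  induction m with
  | zero => rw [Function.iterate_zero_apply, iterate_wirtinger_gauss, zero_add]
  | succ m ih =>
    rw [Function.iterate_succ_apply', ih]
    ext z
    rw [wirtingerBar_of_hasFDerivAt (hasFDerivAt_polyHermite_mul_gauss _ _ _ _),
      polyHermite_succ]
    ring

lemma univHermite_eq (m n : ℕ) (z : ℂ) : univHermite m n z = polyHermite z (conj z) m n := by
  rw [univHermite, iterate_wirtingerBar_gauss]
  have h1 : ((Real.exp (‖z‖ ^ 2) : ℝ) : ℂ) * (Real.exp (-‖z‖ ^ 2) : ℝ) = 1 := by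
    rw [← ofReal_mul, ← Real.exp_add, add_neg_cancel, Real.exp_zero, ofReal_one]
  have h2 : ((-1 : ℂ) ^ (m + n)) * (-1) ^ (m + n) = 1 := by
    rw [← mul_pow]; simp
  linear_combination ((-1 : ℂ) ^ (m + n)) * (-1) ^ (m + n) * polyHermite z (conj z) m n * h1
    + polyHermite z (conj z) m n * h2

/-! ### The bivariate polynomials as smooth functions -/

/-- `H_{m,n}` in the smooth variables `x` and `y`. -/
def smoothHermite (x y : Smooth) (m n : ℕ) : Smooth :=
  ⟨fun p => polyHermite (x.1 p) (y.1 p) m n,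
    contDiff_polyHermite (contDiff_smooth x) (contDiff_smooth y) m n⟩

lemma smoothHermite_apply (x y : Smooth) (m n : ℕ) (p : ℂ × ℂ) :
    (smoothHermite x y m n : ℂ × ℂ → ℂ) p = polyHermite (x.1 p) (y.1 p) m n := rfl

lemma dir_smoothHermite (v : ℂ × ℂ) (x y : Smooth) (m n : ℕ) :
    dir v (smoothHermite x y m n) = (m : ℂ) • mulBy (dir v x) (smoothHermite x y (m - 1) n)
      + (n : ℂ) • mulBy (dir v y) (smoothHermite x y m (n - 1)) := by
  ext p
  have h : HasFDerivAt (smoothHermite x y m n : ℂ × ℂ → ℂ) _ p :=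
    hasFDerivAt_polyHermite (differentiable_smooth x p).hasFDerivAt
      (differentiable_smooth y p).hasFDerivAt m n
  rw [dir_apply, h.fderiv]
  simp [dir_apply, smoothHermite_apply]
  ring

lemma A_smoothHermite (j : Fin 4) (x y : Smooth) (m n : ℕ) :
    A j (smoothHermite x y m n) = (m : ℂ) • mulBy (A j x) (smoothHermite x y (m - 1) n)
      + (n : ℂ) • mulBy (A j y) (smoothHermite x y m (n - 1)) := by
  obtain ⟨a, b, c, d, h⟩ := A_eq j
  ext p
  simp only [h, LinearMap.add_apply, LinearMap.smul_apply, dir_smoothHermite, Submodule.coe_add,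
    Submodule.coe_smul, Pi.add_apply, Pi.smul_apply, mulBy_apply, smul_eq_mul]
  ring

lemma dir_zFn (v : ℂ × ℂ) (p : ℂ × ℂ) : (dir v zFn : ℂ × ℂ → ℂ) p = v.1 := by
  have h : HasFDerivAt (zFn : ℂ × ℂ → ℂ) (ContinuousLinearMap.fst ℝ ℂ ℂ) p := hasFDerivAt_fst
  rw [dir_apply, h.fderiv]; rfl

lemma dir_wFn (v : ℂ × ℂ) (p : ℂ × ℂ) : (dir v wFn : ℂ × ℂ → ℂ) p = v.2 := by
  have h : HasFDerivAt (wFn : ℂ × ℂ → ℂ) (ContinuousLinearMap.snd ℝ ℂ ℂ) p := hasFDerivAt_snd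
  rw [dir_apply, h.fderiv]; rfl

lemma A_xi (j k : Fin 4) (p : ℂ × ℂ) :
    (A j (xi k) : ℂ × ℂ → ℂ) p = if j = k then 1 else 0 := by
  fin_cases j <;> fin_cases k <;>
    simp [A, xi, dz, dw, dzBar, dwBar, dir_zFn, dir_wFn, dir_conjFn] <;> ring_nf <;>
    simp <;> ring_nf

/-- `H_M` as a smooth function. -/
def herm (a b c d : ℕ) : Smooth :=
  mulBy (smoothHermite (xi 0) (xi 1) a b) (smoothHermite (xi 2) (xi 3) c d)

lemma herm_apply (a b c d : ℕ) (p : ℂ × ℂ) :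
    (herm a b c d : ℂ × ℂ → ℂ) p = polyHermite ((xi 0).1 p) ((xi 1).1 p) a b
      * polyHermite ((xi 2).1 p) ((xi 3).1 p) c d := rfl

lemma bivHermite_eq (M : Fin 4 → ℕ) :
    bivHermite M = (herm (M 0) (M 1) (M 2) (M 3) : ℂ × ℂ → ℂ) := by
  ext p
  rw [bivHermite, univHermite_eq, univHermite_eq, herm_apply]
  simp [xi, zFn, wFn, sub_eq_add_neg]

lemma A_zero_herm (a b c d : ℕ) : A 0 (herm a b c d) = (a : ℂ) • herm (a - 1) b c d := by
  ext p
  simp [herm, A_mulBy, A_smoothHermite, A_xi, mul_assoc]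

lemma A_one_herm (a b c d : ℕ) : A 1 (herm a b c d) = (b : ℂ) • herm a (b - 1) c d := by
  ext p
  simp [herm, A_mulBy, A_smoothHermite, A_xi, mul_assoc]

lemma A_two_herm (a b c d : ℕ) : A 2 (herm a b c d) = (c : ℂ) • herm a b (c - 1) d := by
  ext p
  simp [herm, A_mulBy, A_smoothHermite, A_xi]

lemma A_three_herm (a b c d : ℕ) : A 3 (herm a b c d) = (d : ℂ) • herm a b c (d - 1) := by
  ext p
  simp [herm, A_mulBy, A_smoothHermite, A_xi]

lemma xi_zero_mul_herm (a b c d : ℕ) :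
    mulBy (xi 0) (herm a b c d) = herm (a + 1) b c d + (b : ℂ) • herm a (b - 1) c d := by
  ext p
  have := mul_polyHermite_left ((xi 0).1 p) ((xi 1).1 p) a b
  simp [herm_apply]
  linear_combination polyHermite ((xi 2).1 p) ((xi 3).1 p) c d * this

lemma xi_one_mul_herm (a b c d : ℕ) :
    mulBy (xi 1) (herm a b c d) = herm a (b + 1) c d + (a : ℂ) • herm (a - 1) b c d := by
  ext p
  have := mul_polyHermite_right ((xi 0).1 p) ((xi 1).1 p) a b
  simp [herm_apply]
  linear_combination polyHermite ((xi 2).1 p) ((xi 3).1 p) c d * this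

lemma xi_two_mul_herm (a b c d : ℕ) :
    mulBy (xi 2) (herm a b c d) = herm a b (c + 1) d + (d : ℂ) • herm a b c (d - 1) := by
  ext p
  have := mul_polyHermite_left ((xi 2).1 p) ((xi 3).1 p) c d
  simp [herm_apply]
  linear_combination polyHermite ((xi 0).1 p) ((xi 1).1 p) a b * this

lemma xi_three_mul_herm (a b c d : ℕ) :
    mulBy (xi 3) (herm a b c d) = herm a b c (d + 1) + (c : ℂ) • herm a b (c - 1) d := by
  ext p
  have := mul_polyHermite_right ((xi 2).1 p) ((xi 3).1 p) c d
  simp [herm_apply]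
  linear_combination polyHermite ((xi 0).1 p) ((xi 1).1 p) a b * this

/-- `H_M` as a smooth function, with a multi-index. -/
def hermM (M : Fin 4 → ℕ) : Smooth := herm (M 0) (M 1) (M 2) (M 3)

/-- For j = 0, ξ A_ξ H_M gives a H_M plus ab times the polynomial with both indices lowered, and A_ξ
A_ξ̄ H_M is exactly that second term. The other cases follow the same pattern. -/
lemma L_hermM (j : Fin 4) (M : Fin 4 → ℕ) : L j (hermM M) = (M j : ℂ) • hermM M := by
  rw [L_apply, hermM]
  generalize hb : M 1 = b
  generalize hd : M 3 = d
  generalize ha : M 0 = a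
  generalize hc : M 2 = c
  fin_cases j
  · simp only [bar, Fin.zero_eta, Fin.isValue, Matrix.cons_val_zero, A_zero_herm, A_one_herm,
      map_smul, xi_zero_mul_herm, ha]
    -- The case split resolves the truncated index in `a - 1 + 1`.
    cases a <;> simp [smul_smul, mul_comm]
  · change mulBy (xi 1) (A 1 _) - A 1 (A 0 _) = (M 1 : ℂ) • _
    simp only [A_zero_herm, A_one_herm, map_smul, xi_one_mul_herm, hb]
    cases b <;> simp [smul_smul, mul_comm]
  · simp only [bar, Fin.reduceFinMk, Fin.isValue, Matrix.cons_val, A_two_herm, A_three_herm,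
      map_smul, xi_two_mul_herm, hc]
    cases c <;> simp [smul_smul, mul_comm]
  · simp only [bar, Fin.reduceFinMk, Fin.isValue, Matrix.cons_val, A_two_herm, A_three_herm,
      map_smul, xi_three_mul_herm, hd]
    cases d <;> simp [smul_smul, mul_comm]

/-- The lowering operators bring a nonzero multiple of H_M down to the constant 1. -/
lemma herm_ne_zero (a b c d : ℕ) : herm a b c d ≠ 0 := by
  induction a with
  | succ a ih =>
    intro h
    have := A_zero_herm (a + 1) b c d
    rw [h, map_zero, eq_comm, smul_eq_zero] at this
    exact this.elim (Nat.cast_ne_zero.2 a.succ_ne_zero) ih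
  | zero =>
  induction b with
  | succ b ih =>
    intro h
    have := A_one_herm 0 (b + 1) c d
    rw [h, map_zero, eq_comm, smul_eq_zero] at this
    exact this.elim (Nat.cast_ne_zero.2 b.succ_ne_zero) ih
  | zero =>
  induction c with
  | succ c ih =>
    intro h
    have := A_two_herm 0 0 (c + 1) d
    rw [h, map_zero, eq_comm, smul_eq_zero] at this
    exact this.elim (Nat.cast_ne_zero.2 c.succ_ne_zero) ih
  | zero =>
  induction d with
  | succ d ih =>
    intro h
    have := A_three_herm 0 0 0 (d + 1)
    rw [h, map_zero, eq_comm, smul_eq_zero] at this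
    exact this.elim (Nat.cast_ne_zero.2 d.succ_ne_zero) ih
  | zero =>
    intro h
    have := congrArg (fun f : Smooth => (f : ℂ × ℂ → ℂ) 0) h
    simp [herm_apply] at this

/-! ### Functions of exponential growth are square integrable -/

/-- At most exponential growth. -/
def ExpGrowth (f : ℂ × ℂ → ℂ) : Prop :=
  ∃ c : ℝ, 0 ≤ c ∧ ∀ p, ‖f p‖ ≤ Real.exp (c * (1 + ‖p‖))

namespace ExpGrowth

lemma mul {f g : ℂ × ℂ → ℂ} (hf : ExpGrowth f) (hg : ExpGrowth g) :
    ExpGrowth fun p => f p * g p := by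
  obtain ⟨a, ha, hf⟩ := hf
  obtain ⟨b, hb, hg⟩ := hg
  refine ⟨a + b, by positivity, fun p => ?_⟩
  rw [norm_mul, add_mul, Real.exp_add]
  exact mul_le_mul (hf p) (hg p) (norm_nonneg _) (Real.exp_pos _).le

lemma sub {f g : ℂ × ℂ → ℂ} (hf : ExpGrowth f) (hg : ExpGrowth g) :
    ExpGrowth fun p => f p - g p := by
  obtain ⟨a, ha, hf⟩ := hf
  obtain ⟨b, hb, hg⟩ := hg
  refine ⟨a + b + 1, by positivity, fun p => (norm_sub_le _ _).trans ?_⟩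
  have hp : 0 ≤ ‖p‖ := norm_nonneg p
  have h1 : Real.exp (a * (1 + ‖p‖)) ≤ Real.exp ((a + b) * (1 + ‖p‖)) := by gcongr; linarith
  have h2 : Real.exp (b * (1 + ‖p‖)) ≤ Real.exp ((a + b) * (1 + ‖p‖)) := by gcongr; linarith
  -- The extra 1 in the growth constant absorbs the factor 2 from adding two exponentials.
  have h3 : (2 : ℝ) ≤ Real.exp (1 + ‖p‖) := by
    have := Real.add_one_le_exp (1 + ‖p‖); linarith
  calc ‖f p‖ + ‖g p‖ ≤ 2 * Real.exp ((a + b) * (1 + ‖p‖)) := by linarith [hf p, hg p]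
    _ ≤ Real.exp (1 + ‖p‖) * Real.exp ((a + b) * (1 + ‖p‖)) := by gcongr
    _ = _ := by rw [← Real.exp_add]; ring_nf

lemma const (k : ℂ) : ExpGrowth fun _ => k := by
  refine ⟨‖k‖, norm_nonneg k, fun p => ?_⟩
  have h1 := Real.add_one_le_exp (‖k‖ * (1 + ‖p‖))
  have : 0 ≤ ‖k‖ * ‖p‖ := by positivity
  linarith

lemma pow {f : ℂ × ℂ → ℂ} (hf : ExpGrowth f) (n : ℕ) : ExpGrowth fun p => f p ^ n := by
  induction n with
  | zero => simpa using const 1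
  | succ n ih => simpa [pow_succ] using ih.mul hf

lemma polyHermite {x y : ℂ × ℂ → ℂ} (hx : ExpGrowth x) (hy : ExpGrowth y) (m n : ℕ) :
    ExpGrowth fun p => polyHermite (x p) (y p) m n := by
  induction m generalizing n with
  | zero => simpa using hy.pow n
  | succ m ih =>
    simp only [polyHermite_succ]
    exact (hx.mul (ih n)).sub ((const (n : ℂ)).mul (ih (n - 1)))

lemma xi (j : Fin 4) : ExpGrowth (xi j : ℂ × ℂ → ℂ) := by
  refine ⟨2, by norm_num, fun p => ?_⟩
  have h1 : ‖p.1‖ ≤ ‖p‖ := norm_fst_le p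
  have h2 : ‖p.2‖ ≤ ‖p‖ := norm_snd_le p
  have h3 := Real.add_one_le_exp (2 * (1 + ‖p‖))
  have h4 : ‖(BivariateHermite.xi j : ℂ × ℂ → ℂ) p‖ ≤ ‖p.1‖ + ‖p.2‖ := by
    fin_cases j
    · exact (norm_add_le _ _).trans (by simp [zFn, wFn])
    · exact (norm_sub_le _ _).trans (by simp [zFn, wFn])
    · exact (norm_add_le _ _).trans (by simp [zFn, wFn])
    · exact (norm_sub_le _ _).trans (by simp [zFn, wFn])
  linarith

lemma herm (a b c d : ℕ) : ExpGrowth (herm a b c d : ℂ × ℂ → ℂ) :=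
  (polyHermite (xi 0) (xi 1) a b).mul (polyHermite (xi 2) (xi 3) c d)

end ExpGrowth

/-- The density of `gaussMeasure`. -/
def weight (p : ℂ × ℂ) : ℝ := Real.exp (-2 * (‖p.1‖ ^ 2 + ‖p.2‖ ^ 2))

lemma measurable_ofReal_weight : Measurable fun p => ENNReal.ofReal (weight p) :=
  (ENNReal.measurable_ofReal.comp continuous_weight.measurable)

lemma gaussMeasure_eq :
    gaussMeasure = (volume : Measure (ℂ × ℂ)).withDensity fun p => ENNReal.ofReal (weight p) := rfl

lemma integral_gaussMeasure (f : ℂ × ℂ → ℂ) :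
    ∫ p, f p ∂gaussMeasure = ∫ p, f p * weight p := by
  rw [gaussMeasure_eq, integral_withDensity_eq_integral_toReal_smul measurable_ofReal_weight
    (by simp)]
  refine integral_congr_ae (.of_forall fun p => ?_)
  simp only [ENNReal.toReal_ofReal (Real.exp_pos _).le, weight, real_smul]
  ring

lemma integrable_exp_neg_norm_sq : Integrable fun z : ℂ => Real.exp (-‖z‖ ^ 2) := by
  have h := (GaussianFourier.integrable_cexp_neg_mul_sq_norm_add (V := ℂ) (b := 1)
    (by simp) 0 0).norm
  refine h.congr (.of_forall fun z => ?_)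
  simp [Complex.norm_exp, ← ofReal_pow]

lemma integrable_exp_gaussMeasure (c : ℝ) :
    Integrable (fun p : ℂ × ℂ => Real.exp (c * (1 + ‖p‖))) gaussMeasure := by
  rw [gaussMeasure_eq, integrable_withDensity_iff measurable_ofReal_weight (by simp)]
  -- Half of the Gaussian exponent absorbs the linear growth, since |c|s ≤ c²/4 + s² for s = ‖z‖ and
  -- s = ‖w‖; the constant exp(|c| + c²) covers the remainder.
  have h := (integrable_exp_neg_norm_sq.mul_prod integrable_exp_neg_norm_sq).const_mul
    (Real.exp (|c| + c ^ 2))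
  refine h.mono' ?_ (.of_forall fun p => ?_)
  · refine Continuous.aestronglyMeasurable ?_
    have : Continuous weight := continuous_weight
    simp only [ENNReal.toReal_ofReal (show 0 ≤ weight _ from (Real.exp_pos _).le)]
    fun_prop
  · have hp : ‖p‖ ≤ ‖p.1‖ + ‖p.2‖ := by
      rw [Prod.norm_def]
      exact max_le (by linarith [norm_nonneg p.2]) (by linarith [norm_nonneg p.1])
    have hw : 0 ≤ weight p := (Real.exp_pos _).le
    rw [ENNReal.toReal_ofReal hw, Real.norm_of_nonneg (by positivity), weight, ← Real.exp_add,
      ← Real.exp_add, ← Real.exp_add]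
    refine Real.exp_le_exp.2 ?_
    have h1 : c * (1 + ‖p‖) ≤ |c| * (1 + (‖p.1‖ + ‖p.2‖)) := by
      have := le_abs_self c
      have := abs_nonneg c
      have := norm_nonneg p
      calc c * (1 + ‖p‖) ≤ |c| * (1 + ‖p‖) := by gcongr
        _ ≤ _ := by gcongr
    nlinarith [sq_nonneg (|c| - 2 * ‖p.1‖), sq_nonneg (|c| - 2 * ‖p.2‖), sq_abs c,
      sq_nonneg c]

lemma ExpGrowth.memLp {f : ℂ × ℂ → ℂ} (hf : ExpGrowth f) (hc : Continuous f) :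
    MemLp f 2 gaussMeasure := by
  obtain ⟨c, -, hf⟩ := hf
  rw [memLp_two_iff_integrable_sq_norm hc.aestronglyMeasurable]
  refine (integrable_exp_gaussMeasure (2 * c)).mono' (by fun_prop) (.of_forall fun p => ?_)
  rw [Real.norm_of_nonneg (by positivity)]
  calc ‖f p‖ ^ 2 ≤ Real.exp (c * (1 + ‖p‖)) ^ 2 := by gcongr; exact hf p
    _ = _ := by rw [← Real.exp_nat_mul]; push_cast; ring_nf

lemma memLp_herm (a b c d : ℕ) : MemLp (herm a b c d : ℂ × ℂ → ℂ) 2 gaussMeasure :=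
  (ExpGrowth.herm a b c d).memLp (contDiff_smooth _).continuous

instance : IsFiniteMeasure gaussMeasure := by
  have h := integrable_exp_gaussMeasure 0
  simp only [zero_mul, Real.exp_zero] at h
  exact (integrable_const_iff_isFiniteMeasure one_ne_zero).1 h

/-! ### Symmetry -/

lemma integrable_test {f : Smooth} (hf : f ∈ TestFn) : Integrable (f : ℂ × ℂ → ℂ) :=
  (contDiff_smooth f).continuous.integrable_of_hasCompactSupport hf

lemma integral_dir {f : Smooth} (hf : f ∈ TestFn) (v : ℂ × ℂ) :
    ∫ p, (dir v f : ℂ × ℂ → ℂ) p = 0 := by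
  have : (volume : Measure (ℂ × ℂ)).IsAddHaarMeasure :=
    inferInstanceAs ((volume : Measure ℂ).prod (volume : Measure ℂ)).IsAddHaarMeasure
  have h0 : Integrable fun p => fderiv ℝ (f : ℂ × ℂ → ℂ) p v :=
    integrable_test (PreservesTest.dir v f hf)
  -- Integration by parts against the constant 1.
  have h := integral_mul_fderiv_eq_neg_fderiv_mul_of_integrable (μ := (volume : Measure (ℂ × ℂ)))
    (f := fun _ : ℂ × ℂ => (1 : ℂ)) (g := (f : ℂ × ℂ → ℂ)) (v := v) (by simp)
    (by simpa using h0)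
    (by simpa using integrable_test hf) (fun x _ => differentiableAt_const _)
    (fun x _ => differentiable_smooth f x)
  simpa [dir_apply] using h

lemma preservesTest_A (j : Fin 4) : PreservesTest (A j) := by
  obtain ⟨a, b, c, d, h⟩ := A_eq j
  rw [h]
  exact ((((PreservesTest.dir _).smul _).add ((PreservesTest.dir _).smul _)).add
    ((PreservesTest.dir _).smul _)).add ((PreservesTest.dir _).smul _)

lemma integral_A {f : Smooth} (hf : f ∈ TestFn) (j : Fin 4) :
    ∫ p, (A j f : ℂ × ℂ → ℂ) p = 0 := by
  obtain ⟨a, b, c, d, h⟩ := A_eq j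
  have hi : ∀ (k : ℂ) (v : ℂ × ℂ), Integrable fun p => k * (dir v f : ℂ × ℂ → ℂ) p :=
    fun k v => (integrable_test (PreservesTest.dir v f hf)).const_mul k
  simp only [h, LinearMap.add_apply, LinearMap.smul_apply, Submodule.coe_add,
    Submodule.coe_smul, Pi.add_apply, Pi.smul_apply, smul_eq_mul]
  refine (integral_add (((hi a (1, 0)).add (hi b (I, 0))).add (hi c (0, 1)))
    (hi d (0, I))).trans ?_
  rw [integral_add' ((hi _ _).add (hi _ _)) (hi _ _), integral_add' (hi _ _) (hi _ _)]
  simp [integral_const_mul, integral_dir hf]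

/-- The weight as a smooth function. -/
def weightFn : Smooth :=
  ⟨fun p => cexp (-((xi 0).1 p * (xi 1).1 p + (xi 2).1 p * (xi 3).1 p)),
    ContDiff.cexp (((contDiff_smooth _).mul (contDiff_smooth _)).add
      ((contDiff_smooth _).mul (contDiff_smooth _))).neg⟩

lemma weightFn_apply (p : ℂ × ℂ) : (weightFn : ℂ × ℂ → ℂ) p = weight p := by
  have h : ∀ z : ℂ, ((‖z‖ : ℝ) : ℂ) ^ 2 = z * conj z := fun z => by
    rw [mul_conj, normSq_eq_norm_sq]; push_cast; rfl
  change cexp _ = _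
  rw [weight, ofReal_exp]
  push_cast
  rw [h, h]
  congr 1
  simp [xi, zFn, wFn]
  linear_combination (-2 * p.2 * conj p.2) * (-I_mul_I)

lemma A_weightFn (j : Fin 4) : A j weightFn = -mulBy (xi (bar j)) weightFn := by
  have hdir : ∀ v, dir v weightFn = -mulBy (mulBy (dir v (xi 0)) (xi 1)
      + mulBy (xi 0) (dir v (xi 1)) + (mulBy (dir v (xi 2)) (xi 3)
      + mulBy (xi 2) (dir v (xi 3)))) weightFn := by
    intro v
    ext p
    have hd := fun k => (differentiable_smooth (xi k) p).hasFDerivAt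
    have h : HasFDerivAt (weightFn : ℂ × ℂ → ℂ) _ p :=
      (((hd 0).mul (hd 1)).add ((hd 2).mul (hd 3))).neg.cexp
    rw [dir_apply, h.fderiv]
    simp [dir_apply, weightFn]
    ring
  have hA : A j weightFn = -mulBy (mulBy (A j (xi 0)) (xi 1)
      + mulBy (xi 0) (A j (xi 1)) + (mulBy (A j (xi 2)) (xi 3)
      + mulBy (xi 2) (A j (xi 3)))) weightFn := by
    obtain ⟨a, b, c, d, h⟩ := A_eq j
    ext p
    simp [h, hdir]
    ring
  rw [hA]
  ext p
  fin_cases j <;> simp [A_xi, bar]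

lemma mulBy_mem_testFn_left {f : Smooth} (hf : f ∈ TestFn) (g : Smooth) : mulBy f g ∈ TestFn := by
  rw [mulBy_comm]; exact PreservesTest.mulBy g f hf

lemma bar_bar (j : Fin 4) : bar (bar j) = j := by fin_cases j <;> rfl

lemma L_apply' (j : Fin 4) (f : Smooth) :
    L j f = mulBy (xi j) (A j f) - A (bar j) (A j f) := by
  rw [L_apply, A_comm]

/-- Green's formula for `L j`. -/
lemma integral_L_mul {f g : Smooth} (hf : f ∈ TestFn) (j : Fin 4) :
    ∫ p, (L j f : ℂ × ℂ → ℂ) p * (g : ℂ × ℂ → ℂ) p * weight p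
      = ∫ p, (A j f : ℂ × ℂ → ℂ) p * (A (bar j) g : ℂ × ℂ → ℂ) p * weight p := by
  have hA := preservesTest_A j f hf
  have hh : mulBy (mulBy (A j f) g) weightFn ∈ TestFn :=
    mulBy_mem_testFn_left (mulBy_mem_testFn_left hA _) _
  -- The product rule: the derivative falling on the weight yields -ξ_j, which reproduces the
  -- first-order term of `L j`. The last term is a total derivative and integrates to zero.
  have key : mulBy (mulBy (L j f) g) weightFn = mulBy (mulBy (A j f) (A (bar j) g)) weightFn
      - A (bar j) (mulBy (mulBy (A j f) g) weightFn) := by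
    rw [A_mulBy, A_mulBy, A_weightFn, bar_bar, L_apply']
    ext p
    simp
    ring
  have h1 : ∀ a b : Smooth, ∀ p, a.1 p * b.1 p * weight p
      = (mulBy (mulBy a b) weightFn : ℂ × ℂ → ℂ) p := by
    intro a b p; simp [weightFn_apply]
  simp only [h1, key]
  have h2 := integral_sub
    (integrable_test (mulBy_mem_testFn_left (mulBy_mem_testFn_left hA (A (bar j) g)) weightFn))
    (integrable_test (preservesTest_A (bar j) _ hh))
  rw [integral_A hh, sub_zero] at h2
  exact h2

lemma conjFn_L (j : Fin 4) (f : Smooth) : conjFn (L j f) = L (bar j) (conjFn f) := by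
  rw [← conjOp_L, conjOp_apply, conjFn_conjFn]

/-- Green's formula reduces both sides to one expression, the integral of `A (bar j)` of conj f
times `A j g` against the weight. -/
lemma integral_conj_L_mul {f g : Smooth} (hf : f ∈ TestFn) (hg : g ∈ TestFn) (j : Fin 4) :
    ∫ p, conj ((L j f : ℂ × ℂ → ℂ) p) * (g : ℂ × ℂ → ℂ) p ∂gaussMeasure
      = ∫ p, conj ((f : ℂ × ℂ → ℂ) p) * (L j g : ℂ × ℂ → ℂ) p ∂gaussMeasure := by
  rw [integral_gaussMeasure, integral_gaussMeasure]
  have h1 := integral_L_mul (g := g) (PreservesTest.conjFn hf) (bar j)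
  have h2 := integral_L_mul (g := conjFn f) hg j
  rw [bar_bar, ← conjFn_L] at h1
  simp only [conjFn_apply] at h1 h2
  rw [h1]
  simp only [mul_comm (conj ((f : ℂ × ℂ → ℂ) _)), h2, mul_comm ((A (bar j) _ : Smooth).1 _)]

/-! ### Cutoffs -/

/-- The function `p ↦ f (r p)`. -/
def scale (r : ℝ) (f : Smooth) : Smooth :=
  ⟨fun p => f.1 (r • p), (contDiff_smooth f).comp (contDiff_const_smul r)⟩

@[simp] lemma scale_apply (r : ℝ) (f : Smooth) (p : ℂ × ℂ) :
    (scale r f : ℂ × ℂ → ℂ) p = f.1 (r • p) := rfl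

lemma scale_mem_testFn {r : ℝ} (hr : r ≠ 0) {f : Smooth} (hf : f ∈ TestFn) :
    scale r f ∈ TestFn :=
  HasCompactSupport.comp_smul hf hr

lemma dir_scale (v : ℂ × ℂ) (r : ℝ) (f : Smooth) :
    dir v (scale r f) = (r : ℂ) • scale r (dir v f) := by
  ext p
  have h := (differentiable_smooth f (r • p)).hasFDerivAt.comp p
    ((hasFDerivAt_id (𝕜 := ℝ) p).const_smul r)
  have h2 : HasFDerivAt (scale r f : ℂ × ℂ → ℂ) _ p := h
  rw [dir_apply, h2.fderiv]
  simp [dir_apply]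

lemma A_scale (j : Fin 4) (r : ℝ) (f : Smooth) :
    A j (scale r f) = (r : ℂ) • scale r (A j f) := by
  obtain ⟨a, b, c, d, h⟩ := A_eq j
  ext p
  simp [h, dir_scale]
  ring

lemma xi_smul (j : Fin 4) (r : ℝ) (p : ℂ × ℂ) :
    (xi j : ℂ × ℂ → ℂ) (r • p) = r * (xi j : ℂ × ℂ → ℂ) p := by
  fin_cases j <;> simp [xi, zFn, wFn] <;> ring

lemma L_mulBy (j : Fin 4) (k f : Smooth) :
    L j (mulBy k f) = mulBy k (L j f) + mulBy (mulBy (xi j) (A j k)) f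
      - mulBy (A j k) (A (bar j) f) - mulBy (A (bar j) k) (A j f)
      - mulBy (A j (A (bar j) k)) f := by
  simp only [L_apply, A_mulBy, map_add]
  ext p
  simp
  ring

/-- Every error term except ξ_j A_j k carries a factor r. There the r from differentiating turns
ξ_j(p) into ξ_j(r p), so the term is again a rescaled test function. -/
lemma L_mulBy_scale (j : Fin 4) (r : ℝ) (k f : Smooth) :
    L j (mulBy (scale r k) f) = mulBy (scale r k) (L j f)
      + mulBy (scale r (mulBy (xi j) (A j k))) f
      + (-(r : ℂ)) • mulBy (scale r (A j k)) (A (bar j) f)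
      + (-(r : ℂ)) • mulBy (scale r (A (bar j) k)) (A j f)
      + (-(r : ℂ) * r) • mulBy (scale r (A j (A (bar j) k))) f := by
  simp only [L_mulBy, A_scale, map_smul]
  ext p
  simp [xi_smul]
  ring

lemma norm_toLp_sq {f : ℂ × ℂ → ℂ} (hf : MemLp f 2 gaussMeasure) :
    ‖hf.toLp f‖ ^ 2 = ∫ p, ‖f p‖ ^ 2 ∂gaussMeasure := by
  have h := L2.inner_def (𝕜 := ℂ) (hf.toLp f) (hf.toLp f)
  rw [inner_self_eq_norm_sq_to_K] at h
  have h2 : ∫ p, inner ℂ (hf.toLp f p) (hf.toLp f p) ∂gaussMeasure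
      = ∫ p, ((‖f p‖ ^ 2 : ℝ) : ℂ) ∂gaussMeasure := by
    refine integral_congr_ae ?_
    filter_upwards [hf.coeFn_toLp] with p hp
    rw [hp, inner_self_eq_norm_sq_to_K]
    push_cast
    rfl
  rw [h2, integral_complex_ofReal] at h
  exact Complex.ofReal_injective (by rw [ofReal_pow]; exact h)

/-- The test function `p ↦ k (r p) f p`. -/
def cut (k : TestFn) {r : ℝ} (hr : r ≠ 0) (f : Smooth) : TestFn :=
  ⟨mulBy (scale r k) f, mulBy_mem_testFn_left (scale_mem_testFn hr k.2) f⟩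

/-- Dominated convergence with bound (2C)²|f|². The value k(0) is kept general because the lemma
also treats the error terms of the cutoff. -/
lemma tendsto_cut (k : TestFn) {r : ℕ → ℝ} (hr : ∀ n, r n ≠ 0)
    (hr0 : Filter.Tendsto r Filter.atTop (nhds 0)) {f : Smooth}
    (hf : MemLp (f : ℂ × ℂ → ℂ) 2 gaussMeasure) :
    Filter.Tendsto (fun n => toL2 (cut k (hr n) f)) Filter.atTop
      (nhds ((k : ℂ × ℂ → ℂ) 0 • hf.toLp _)) := by
  have hkc := (contDiff_smooth k.1).continuous
  have hfc := (contDiff_smooth f).continuous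
  obtain ⟨C, hC⟩ := hkc.bounded_above_of_compact_support k.2
  have hC0 : 0 ≤ C := (norm_nonneg _).trans (hC 0)
  rw [tendsto_iff_norm_sub_tendsto_zero]
  have hmem : ∀ n, MemLp (fun p => (k : ℂ × ℂ → ℂ) (r n • p) * (f : ℂ × ℂ → ℂ) p
      - (k : ℂ × ℂ → ℂ) 0 * (f : ℂ × ℂ → ℂ) p) 2 gaussMeasure := fun n =>
    (memLp_test (cut k (hr n) f)).sub (hf.const_mul _)
  have heq : ∀ n, ‖toL2 (cut k (hr n) f) - (k : ℂ × ℂ → ℂ) 0 • hf.toLp _‖ ^ 2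
      = ∫ p, ‖(k : ℂ × ℂ → ℂ) (r n • p) * (f : ℂ × ℂ → ℂ) p
          - (k : ℂ × ℂ → ℂ) 0 * (f : ℂ × ℂ → ℂ) p‖ ^ 2 ∂gaussMeasure := by
    intro n
    rw [← norm_toLp_sq (hmem n)]
    rfl
  have hlim : Filter.Tendsto (fun n => ‖toL2 (cut k (hr n) f)
      - (k : ℂ × ℂ → ℂ) 0 • hf.toLp _‖ ^ 2) Filter.atTop (nhds 0) := by
    simp only [heq]
    have h0 : (0 : ℝ) = ∫ _ : ℂ × ℂ, (0 : ℝ) ∂gaussMeasure := by simp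
    rw [h0]
    refine tendsto_integral_of_dominated_convergence
      (fun p => (2 * C) ^ 2 * ‖(f : ℂ × ℂ → ℂ) p‖ ^ 2) (fun n => ?_) ?_ (fun n => ?_) ?_
    · exact Continuous.aestronglyMeasurable (by fun_prop)
    · exact ((memLp_two_iff_integrable_sq_norm hfc.aestronglyMeasurable).1 hf).const_mul _
    · refine .of_forall fun p => ?_
      rw [Real.norm_of_nonneg (by positivity), ← mul_pow, ← sub_mul, norm_mul]
      gcongr
      refine (norm_sub_le _ _).trans ?_
      linarith [hC (r n • p), hC 0]
    · refine .of_forall fun p => ?_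
      have h1 : Filter.Tendsto (fun n => r n • p) Filter.atTop (nhds 0) := by
        simpa using hr0.smul_const p
      have h2 : Filter.Tendsto (fun n => (k : ℂ × ℂ → ℂ) (r n • p)) Filter.atTop
          (nhds ((k : ℂ × ℂ → ℂ) 0)) := (hkc.tendsto 0).comp h1
      have h3 := ((h2.mul_const ((f : ℂ × ℂ → ℂ) p)).sub_const
        ((k : ℂ × ℂ → ℂ) 0 * (f : ℂ × ℂ → ℂ) p)).norm.pow 2
      simpa using h3
  have := hlim.sqrt
  simpa using this

/-- A cutoff function. -/
lemma exists_cutoff : ∃ k : TestFn, (k : ℂ × ℂ → ℂ) 0 = 1 := by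
  let b : ContDiffBump (0 : ℂ × ℂ) := ⟨1, 2, by norm_num, by norm_num⟩
  refine ⟨⟨⟨fun p => (b p : ℂ), Complex.ofRealCLM.contDiff.comp b.contDiff⟩, ?_⟩, ?_⟩
  · exact HasCompactSupport.comp_left (g := fun x : ℝ => (x : ℂ)) b.hasCompactSupport rfl
  · change ((b 0 : ℝ) : ℂ) = 1
    rw [b.one_of_mem_closedBall (by simp [b])]
    rfl

lemma xi_zero (j : Fin 4) : (xi j : ℂ × ℂ → ℂ) 0 = 0 := by
  fin_cases j <;> simp [xi, zFn, wFn]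

/-- A smooth function is in the domain of the closure of `L j` if all the derivatives that occur
are square integrable. -/
lemma exists_tendsto_test (j : Fin 4) {f : Smooth} (hf : MemLp (f : ℂ × ℂ → ℂ) 2 gaussMeasure)
    (hL : MemLp (L j f : ℂ × ℂ → ℂ) 2 gaussMeasure)
    (hA : MemLp (A j f : ℂ × ℂ → ℂ) 2 gaussMeasure)
    (hA' : MemLp (A (bar j) f : ℂ × ℂ → ℂ) 2 gaussMeasure) :
    ∃ u v : ℕ → TestFn, (∀ n, (v n : Smooth) = L j (u n)) ∧
      Filter.Tendsto (fun n => toL2 (u n)) Filter.atTop (nhds (hf.toLp _)) ∧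
      Filter.Tendsto (fun n => toL2 (v n)) Filter.atTop (nhds (hL.toLp _)) := by
  obtain ⟨k, hk⟩ := exists_cutoff
  set r : ℕ → ℝ := fun n => 1 / ((n : ℝ) + 1)
  have hr : ∀ n, r n ≠ 0 := fun n => by positivity
  have hr0 : Filter.Tendsto r Filter.atTop (nhds 0) := tendsto_one_div_add_atTop_nhds_zero_nat
  have hrc : Filter.Tendsto (fun n => (r n : ℂ)) Filter.atTop (nhds 0) := by
    have := (Complex.continuous_ofReal.tendsto 0).comp hr0
    rw [ofReal_zero] at this
    exact this
  let k1 : TestFn := ⟨mulBy (xi j) (A j k), PreservesTest.mulBy _ _ (preservesTest_A j _ k.2)⟩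
  let k2 : TestFn := ⟨A j k, preservesTest_A j _ k.2⟩
  let k3 : TestFn := ⟨A (bar j) k, preservesTest_A _ _ k.2⟩
  let k4 : TestFn := ⟨A j (A (bar j) k), preservesTest_A _ _ (preservesTest_A _ _ k.2)⟩
  refine ⟨fun n => cut k (hr n) f, fun n => cut k (hr n) (L j f) + cut k1 (hr n) f
    + (-(r n : ℂ)) • cut k2 (hr n) (A (bar j) f) + (-(r n : ℂ)) • cut k3 (hr n) (A j f)
    + (-(r n : ℂ) * r n) • cut k4 (hr n) f, fun n => (L_mulBy_scale j (r n) k f).symm, ?_, ?_⟩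
  · simpa [hk] using tendsto_cut k hr hr0 hf
  -- The one error term without a factor r disappears because ξ_j vanishes at the origin.
  · have h1 : (k1 : ℂ × ℂ → ℂ) 0 = 0 := by simp [k1, xi_zero]
    have := ((((tendsto_cut k hr hr0 hL).add (tendsto_cut k1 hr hr0 hf)).add
      (hrc.neg.smul (tendsto_cut k2 hr hr0 hA'))).add
      (hrc.neg.smul (tendsto_cut k3 hr hr0 hA))).add
      ((hrc.neg.mul hrc).smul (tendsto_cut k4 hr hr0 hf))
    simp only [hk, h1, one_smul, zero_smul, add_zero, neg_zero, mul_zero] at this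
    refine this.congr fun n => ?_
    simp only [map_add, map_smul]

/-! ### Completeness of the Hermite polynomials -/

/-- The linear span of the `H_M`, as smooth functions. -/
def hermSpan : Submodule ℂ Smooth := Submodule.span ℂ (Set.range hermM)

lemma herm_mem_hermSpan (a b c d : ℕ) : herm a b c d ∈ hermSpan :=
  Submodule.subset_span ⟨![a, b, c, d], rfl⟩

lemma xi_mulBy_mem_hermSpan (j : Fin 4) {f : Smooth} (hf : f ∈ hermSpan) :
    mulBy (xi j) f ∈ hermSpan := by
  have h : hermSpan ≤ hermSpan.comap (mulBy (xi j)) := by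
    refine Submodule.span_le.2 ?_
    rintro _ ⟨M, rfl⟩
    change mulBy (xi j) (herm _ _ _ _) ∈ hermSpan
    fin_cases j
    · exact xi_zero_mul_herm _ _ _ _ ▸ hermSpan.add_mem (herm_mem_hermSpan _ _ _ _)
        (hermSpan.smul_mem _ (herm_mem_hermSpan _ _ _ _))
    · exact xi_one_mul_herm _ _ _ _ ▸ hermSpan.add_mem (herm_mem_hermSpan _ _ _ _)
        (hermSpan.smul_mem _ (herm_mem_hermSpan _ _ _ _))
    · exact xi_two_mul_herm _ _ _ _ ▸ hermSpan.add_mem (herm_mem_hermSpan _ _ _ _)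
        (hermSpan.smul_mem _ (herm_mem_hermSpan _ _ _ _))
    · exact xi_three_mul_herm _ _ _ _ ▸ hermSpan.add_mem (herm_mem_hermSpan _ _ _ _)
        (hermSpan.smul_mem _ (herm_mem_hermSpan _ _ _ _))
  exact h hf

lemma exists_linear_eq_xi (l : StrongDual ℝ (ℂ × ℂ)) :
    ∃ c : Fin 4 → ℂ, ∀ p, (l p : ℂ) = ∑ j, c j * (xi j : ℂ × ℂ → ℂ) p := by
  set a : ℂ := ((l (1, 0) : ℝ) : ℂ)
  set b : ℂ := ((l (I, 0) : ℝ) : ℂ)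
  set c : ℂ := ((l (0, 1) : ℝ) : ℂ)
  set d : ℂ := ((l (0, I) : ℝ) : ℂ)
  -- The coefficients are the constants `A j` l, since the `A j` are dual to the `xi j`.
  refine ⟨![(a - I * b - I * c - d) / 4, (a + I * b + I * c - d) / 4,
    (a + I * b - I * c + d) / 4, (a - I * b + I * c + d) / 4], fun p => ?_⟩
  have hp : p = p.1.re • ((1, 0) : ℂ × ℂ) + p.1.im • ((I, 0) : ℂ × ℂ)
      + p.2.re • ((0, 1) : ℂ × ℂ) + p.2.im • ((0, I) : ℂ × ℂ) := by
    ext <;> simp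
  have hl : (l p : ℂ) = p.1.re * a + p.1.im * b + p.2.re * c + p.2.im * d := by
    conv_lhs => rw [hp]
    simp only [map_add, map_smul, smul_eq_mul, ofReal_add, ofReal_mul]
    rfl
  have h1 : p.1 = p.1.re + p.1.im * I := (re_add_im _).symm
  have h2 : p.2 = p.2.re + p.2.im * I := (re_add_im _).symm
  have h3 : conj p.1 = p.1.re - p.1.im * I := Complex.ext (by simp) (by simp)
  have h4 : conj p.2 = p.2.re - p.2.im * I := Complex.ext (by simp) (by simp)
  rw [hl, Fin.sum_univ_four]
  simp only [xi, Matrix.cons_val, Submodule.coe_add, Submodule.coe_sub, Submodule.coe_smul,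
    Pi.add_apply, Pi.sub_apply, Pi.smul_apply, smul_eq_mul, conjFn_apply]
  change _ = _ * (p.1 + I * p.2) + _ * (conj p.1 - I * conj p.2) + _ * (conj p.1 + I * conj p.2)
    + _ * (p.1 - I * p.2)
  rw [h3, h4]
  generalize p.1.re = x at *
  generalize p.1.im = y at *
  generalize p.2.re = u at *
  generalize p.2.im = v at *
  rw [h1, h2]
  ring_nf
  simp only [I_sq]
  ring

lemma exists_pow_linear_mem_hermSpan (l : StrongDual ℝ (ℂ × ℂ)) (n : ℕ) :
    ∃ f ∈ hermSpan, ∀ p, (f : ℂ × ℂ → ℂ) p = (l p : ℂ) ^ n := by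
  induction n with
  | zero => exact ⟨herm 0 0 0 0, herm_mem_hermSpan _ _ _ _, fun p => by simp [herm_apply]⟩
  | succ n ih =>
    obtain ⟨f, hf, hfl⟩ := ih
    obtain ⟨c, hc⟩ := exists_linear_eq_xi l
    refine ⟨∑ j, c j • mulBy (xi j) f, hermSpan.sum_mem fun j _ =>
      hermSpan.smul_mem _ (xi_mulBy_mem_hermSpan j hf), fun p => ?_⟩
    rw [pow_succ', ← hfl, hc, Finset.sum_mul]
    simp [Fin.sum_univ_four, mul_assoc]

lemma expGrowth_exp_linear (l : StrongDual ℝ (ℂ × ℂ)) :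
    ExpGrowth fun p => (Real.exp |l p| : ℂ) := by
  refine ⟨‖l‖, norm_nonneg _, fun p => ?_⟩
  rw [Complex.norm_real, Real.norm_of_nonneg (Real.exp_pos _).le]
  refine Real.exp_le_exp.2 ?_
  have h := l.le_opNorm p
  rw [Real.norm_eq_abs] at h
  linarith [norm_nonneg l]

/-- If a square integrable function is orthogonal to all powers of the real linear form `l`, then
its integral against `e^{il}` vanishes. -/
lemma integral_mul_cexp_eq_zero {u : ℂ × ℂ → ℂ} (hu : MemLp u 2 gaussMeasure)
    (l : StrongDual ℝ (ℂ × ℂ)) (h : ∀ n : ℕ, ∫ p, u p * (l p : ℂ) ^ n ∂gaussMeasure = 0) :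
    ∫ p, u p * cexp (l p * I) ∂gaussMeasure = 0 := by
  -- The exponential series is integrated termwise; the dominating series sums to |u| exp|l|, a
  -- product of two square integrable functions.
  have hsum := hasSum_integral_of_dominated_convergence (μ := gaussMeasure)
    (F := fun (n : ℕ) p => u p * ((l p * I : ℂ) ^ n / n.factorial))
    (f := fun p => u p * cexp (l p * I))
    (fun n p => ‖u p‖ * (|l p| ^ n / n.factorial)) (fun n => ?_) (fun n => ?_) ?_ ?_ ?_
  · refine hsum.unique ?_
    have : ∀ n : ℕ, ∫ p, u p * ((l p * I : ℂ) ^ n / n.factorial) ∂gaussMeasure = 0 := by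
      intro n
      have e : ∀ p, u p * ((l p * I : ℂ) ^ n / n.factorial)
          = (I ^ n / n.factorial) * (u p * (l p : ℂ) ^ n) := fun p => by
        rw [mul_pow]; ring
      simp only [e]
      rw [integral_const_mul, h, mul_zero]
    simp [this]
  · exact hu.1.mul (Continuous.aestronglyMeasurable (by fun_prop))
  · refine .of_forall fun p => le_of_eq ?_
    simp
  · refine .of_forall fun p => ?_
    exact (Real.summable_pow_div_factorial |l p|).mul_left _
  · have e : ∀ p, ∑' n : ℕ, ‖u p‖ * (|l p| ^ n / n.factorial) = ‖u p‖ * Real.exp |l p| := by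
      intro p
      rw [tsum_mul_left, Real.exp_eq_exp_ℝ, NormedSpace.exp_eq_tsum_div]
    simp only [e]
    have hg := (expGrowth_exp_linear l).memLp (by fun_prop)
    refine (hu.norm.integrable_mul hg.norm).congr (.of_forall fun p => ?_)
    simp
  · refine .of_forall fun p => HasSum.mul_left _ ?_
    rw [Complex.exp_eq_exp_ℂ]
    exact NormedSpace.expSeries_div_hasSum_exp _

/-- Injectivity of the Fourier transform for integrable real densities. -/
lemma ae_eq_zero_of_integral_mul_cexp {μ : Measure (ℂ × ℂ)} [IsFiniteMeasure μ]
    {h : ℂ × ℂ → ℝ} (hi : Integrable h μ)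
    (h0 : ∀ l : StrongDual ℝ (ℂ × ℂ), ∫ p, (h p : ℂ) * cexp (l p * I) ∂μ = 0) : h =ᵐ[μ] 0 := by
  have hfin : ∀ g : ℂ × ℂ → ℝ, Integrable g μ →
      IsFiniteMeasure (μ.withDensity fun p => ENNReal.ofReal (g p)) := fun g hg =>
    isFiniteMeasure_withDensity_ofReal hg.2
  have hin : Integrable (fun p => -h p) μ := hi.neg
  have := hfin h hi
  have := hfin _ hin
  have hchar : ∀ g : ℂ × ℂ → ℝ, Integrable g μ → ∀ l : StrongDual ℝ (ℂ × ℂ),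
      charFunDual (μ.withDensity fun p => ENNReal.ofReal (g p)) l
        = ∫ p, ((max (g p) 0 : ℝ) : ℂ) * cexp (l p * I) ∂μ := by
    intro g hg l
    rw [charFunDual_apply, integral_withDensity_eq_integral_toReal_smul₀
      hg.1.aemeasurable.ennreal_ofReal (by simp)]
    refine integral_congr_ae (.of_forall fun p => ?_)
    simp [ENNReal.toReal_ofReal', real_smul]
  have hint : ∀ g : ℂ × ℂ → ℝ, Integrable g μ → ∀ l : StrongDual ℝ (ℂ × ℂ),
      Integrable (fun p => ((max (g p) 0 : ℝ) : ℂ) * cexp (l p * I)) μ := by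
    intro g hg l
    refine hg.pos_part.ofReal.mul_bdd (c := 1)
      (Continuous.aestronglyMeasurable (by fun_prop)) (.of_forall fun p => ?_)
    rw [Complex.norm_exp_ofReal_mul_I]
  -- The positive and negative parts of h are densities of finite measures with the same
  -- characteristic function, so they agree.
  have heq : μ.withDensity (fun p => ENNReal.ofReal (h p))
      = μ.withDensity fun p => ENNReal.ofReal (-h p) := by
    refine Measure.ext_of_charFunDual (funext fun l => ?_)
    rw [hchar h hi, hchar _ hin, ← sub_eq_zero,
      ← integral_sub (hint h hi l) (hint _ hin l), ← h0 l]
    refine integral_congr_ae (.of_forall fun p => ?_)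
    have e : max (h p) 0 - max (-h p) 0 = h p := max_zero_sub_max_neg_zero_eq_self _
    simp only
    rw [← sub_mul, ← ofReal_sub, e]
  rw [withDensity_eq_iff_of_sigmaFinite hi.1.aemeasurable.ennreal_ofReal
    hin.1.aemeasurable.ennreal_ofReal] at heq
  filter_upwards [heq] with p hp
  have e : max (h p) 0 - max (-h p) 0 = h p := max_zero_sub_max_neg_zero_eq_self _
  have h2 := congrArg ENNReal.toReal hp
  rw [ENNReal.toReal_ofReal', ENNReal.toReal_ofReal'] at h2
  rw [Pi.zero_apply, ← e, h2, sub_self]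

/-- Conjugation sends l to -l, so the transform of conj u vanishes too; the real and imaginary parts
of u can then be treated separately. -/
lemma ae_eq_zero_of_integral_mul_pow {u : ℂ × ℂ → ℂ} (hu : MemLp u 2 gaussMeasure)
    (h : ∀ (l : StrongDual ℝ (ℂ × ℂ)) (n : ℕ), ∫ p, u p * (l p : ℂ) ^ n ∂gaussMeasure = 0) :
    u =ᵐ[gaussMeasure] 0 := by
  have hui : Integrable u gaussMeasure := hu.integrable (by norm_num)
  have hexp : ∀ l : StrongDual ℝ (ℂ × ℂ), ∫ p, u p * cexp (l p * I) ∂gaussMeasure = 0 :=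
    fun l => integral_mul_cexp_eq_zero hu l (h l)
  have hi : ∀ l : StrongDual ℝ (ℂ × ℂ),
      Integrable (fun p => u p * cexp (l p * I)) gaussMeasure := fun l =>
    hui.mul_bdd (c := 1) (Continuous.aestronglyMeasurable (by fun_prop))
      (.of_forall fun p => by rw [Complex.norm_exp_ofReal_mul_I])
  have hcexp : ∀ l : StrongDual ℝ (ℂ × ℂ), ∀ p, conj (cexp ((-l) p * I)) = cexp (l p * I) := by
    intro l p
    rw [← Complex.exp_conj]
    simp
  have hconj : ∀ l : StrongDual ℝ (ℂ × ℂ),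
      ∫ p, conj (u p) * cexp (l p * I) ∂gaussMeasure = 0 := by
    intro l
    have h1 := congrArg conj (hexp (-l))
    rw [← integral_conj, map_zero] at h1
    simpa only [map_mul, hcexp] using h1
  have hi' : ∀ l : StrongDual ℝ (ℂ × ℂ),
      Integrable (fun p => conj (u p) * cexp (l p * I)) gaussMeasure := by
    intro l
    have h1 := (conjCLE : ℂ →L[ℝ] ℂ).integrable_comp (hi (-l))
    refine h1.congr (.of_forall fun p => ?_)
    simp only [ContinuousLinearEquiv.coe_coe, conjCLE_apply, map_mul, hcexp]
  have hre : (fun p => (u p).re) =ᵐ[gaussMeasure] 0 := by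
    refine ae_eq_zero_of_integral_mul_cexp hui.re fun l => ?_
    have e : ∀ p, ((u p).re : ℂ) * cexp (l p * I)
        = (1 / 2) * (u p * cexp (l p * I) + conj (u p) * cexp (l p * I)) := fun p => by
      rw [re_eq_add_conj]; ring
    simp only [e]
    rw [integral_const_mul, integral_add (hi l) (hi' l), hexp, hconj, add_zero, mul_zero]
  have him : (fun p => (u p).im) =ᵐ[gaussMeasure] 0 := by
    refine ae_eq_zero_of_integral_mul_cexp hui.im fun l => ?_
    have e : ∀ p, ((u p).im : ℂ) * cexp (l p * I)
        = (1 / (2 * I)) * (u p * cexp (l p * I) - conj (u p) * cexp (l p * I)) := fun p => by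
      rw [im_eq_sub_conj]; ring
    simp only [e]
    rw [integral_const_mul, integral_sub (hi l) (hi' l), hexp, hconj, sub_zero, mul_zero]
  filter_upwards [hre, him] with p h1 h2
  exact Complex.ext h1 h2

/-- The class of `H_M` in the Hilbert space. -/
def hermL2 (M : Fin 4 → ℕ) : GaussL2 := (memLp_herm (M 0) (M 1) (M 2) (M 3)).toLp _

lemma coeFn_hermL2 (M : Fin 4 → ℕ) : hermL2 M =ᵐ[gaussMeasure] bivHermite M := by
  rw [bivHermite_eq]
  exact (memLp_herm _ _ _ _).coeFn_toLp

/-- The Hermite polynomials are complete. -/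
lemma span_hermL2_dense :
    (Submodule.span ℂ (Set.range hermL2)).topologicalClosure = ⊤ := by
  rw [Submodule.topologicalClosure_eq_top_iff, Submodule.eq_bot_iff]
  intro u hu
  have hherm : ∀ f ∈ hermSpan, Integrable (fun p => u p * conj ((f : ℂ × ℂ → ℂ) p)) gaussMeasure ∧
      ∫ p, u p * conj ((f : ℂ × ℂ → ℂ) p) ∂gaussMeasure = 0 := by
    intro f hf
    induction hf using Submodule.span_induction with
    | mem f hf =>
      obtain ⟨M, rfl⟩ := hf
      have h1 : inner ℂ (hermL2 M) u = 0 :=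
        (Submodule.mem_orthogonal _ _).1 hu _ (Submodule.subset_span ⟨M, rfl⟩)
      have hm := memLp_herm (M 0) (M 1) (M 2) (M 3)
      refine ⟨(Lp.memLp u).integrable_mul hm.star, ?_⟩
      rw [L2.inner_def] at h1
      rw [← h1]
      refine integral_congr_ae ?_
      filter_upwards [hm.coeFn_toLp] with p hp
      rw [hermL2, hp, RCLike.inner_apply]
      rfl
    | zero => simp
    | add f g _ _ hf hg =>
      simp only [Submodule.coe_add, Pi.add_apply, map_add, mul_add]
      exact ⟨hf.1.add hg.1, by rw [integral_add hf.1 hg.1, hf.2, hg.2, add_zero]⟩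
    | smul c f _ hf =>
      simp only [Submodule.coe_smul, Pi.smul_apply, smul_eq_mul, map_mul, mul_left_comm _ (conj c)]
      exact ⟨hf.1.const_mul _, by rw [integral_const_mul, hf.2, mul_zero]⟩
  have h0 : u =ᵐ[gaussMeasure] 0 := by
    refine ae_eq_zero_of_integral_mul_pow (Lp.memLp u) fun l n => ?_
    obtain ⟨f, hf, hfl⟩ := exists_pow_linear_mem_hermSpan l n
    -- The linear form is real, so the conjugate in the inner product leaves its powers unchanged.
    simpa [hfl] using (hherm f hf).2
  exact (Lp.eq_zero_iff_ae_eq_zero).2 h0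

/-! ### The closure of the operators in the Hilbert space -/

lemma mem_graph_minimalOp (j : Fin 4) {f g : TestFn} (h : (g : Smooth) = L j f) :
    (toL2 f, toL2 g) ∈ (minimalOp j).graph := by
  refine ((minimalOp j).mem_graph_iff).2 ⟨⟨toL2 f, f, rfl⟩, rfl, ?_⟩
  have h1 : (LinearEquiv.ofInjective toL2 toL2_injective).symm ⟨toL2 f, f, rfl⟩ = f := by
    rw [LinearEquiv.symm_apply_eq]; rfl
  change toL2 ((S j).restrict (S_preservesTest j)
    ((LinearEquiv.ofInjective toL2 toL2_injective).symm ⟨toL2 f, f, rfl⟩)) = toL2 g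
  rw [h1]
  congr 1
  ext1
  rw [h, ← S_eq_L]
  rfl

lemma exists_of_mem_graph_minimalOp (j : Fin 4) {x : GaussL2 × GaussL2}
    (hx : x ∈ (minimalOp j).graph) :
    ∃ f g : TestFn, (g : Smooth) = L j f ∧ x = (toL2 f, toL2 g) := by
  obtain ⟨y, h1, h2⟩ := ((minimalOp j).mem_graph_iff).1 hx
  obtain ⟨f, hf⟩ : (y : GaussL2) ∈ LinearMap.range toL2 := y.2
  let g : TestFn := ⟨S j f, S_preservesTest j f f.2⟩
  have hg : (g : Smooth) = L j f := by rw [← S_eq_L]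
  obtain ⟨z, hz1, hz2⟩ := ((minimalOp j).mem_graph_iff).1 (mem_graph_minimalOp j hg)
  have hzy : z = y := Subtype.ext (hz1.trans hf)
  refine ⟨f, g, hg, Prod.ext (h1.symm.trans hf.symm) (h2.symm.trans ?_)⟩
  rw [← hzy]
  exact hz2

lemma inner_toL2 (f g : TestFn) : inner ℂ (toL2 f) (toL2 g)
    = ∫ p, conj ((f : ℂ × ℂ → ℂ) p) * (g : ℂ × ℂ → ℂ) p ∂gaussMeasure := by
  rw [L2.inner_def]
  refine integral_congr_ae ?_
  filter_upwards [(memLp_test f).coeFn_toLp, (memLp_test g).coeFn_toLp] with p h1 h2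
  change inner ℂ ((memLp_test f).toLp _ p) ((memLp_test g).toLp _ p) = _
  rw [h1, h2, RCLike.inner_apply, mul_comm]

lemma minimalOp_symm (j : Fin 4) : (minimalOp j).IsFormalAdjoint (minimalOp j) := by
  intro x y
  obtain ⟨f, g, hg, hfg⟩ := exists_of_mem_graph_minimalOp j ((minimalOp j).mem_graph x)
  obtain ⟨f', g', hg', hfg'⟩ := exists_of_mem_graph_minimalOp j ((minimalOp j).mem_graph y)
  rw [Prod.mk.injEq] at hfg hfg'
  rw [hfg.1, hfg.2, hfg'.1, hfg'.2, inner_toL2, inner_toL2, hg, hg']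
  exact integral_conj_L_mul f.2 f'.2 j

lemma memLp_smul_hermM (c : ℂ) (M : Fin 4 → ℕ) :
    MemLp ((c • hermM M : Smooth) : ℂ × ℂ → ℂ) 2 gaussMeasure :=
  (memLp_herm _ _ _ _).const_smul c

lemma memLp_A_hermM (j : Fin 4) (M : Fin 4 → ℕ) :
    MemLp (A j (hermM M) : ℂ × ℂ → ℂ) 2 gaussMeasure := by
  fin_cases j
  · exact (A_zero_herm (M 0) (M 1) (M 2) (M 3)) ▸ (memLp_herm _ _ _ _).const_smul _
  · exact (A_one_herm (M 0) (M 1) (M 2) (M 3)) ▸ (memLp_herm _ _ _ _).const_smul _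
  · exact (A_two_herm (M 0) (M 1) (M 2) (M 3)) ▸ (memLp_herm _ _ _ _).const_smul _
  · exact (A_three_herm (M 0) (M 1) (M 2) (M 3)) ▸ (memLp_herm _ _ _ _).const_smul _

lemma hermL2_mem_closure_graph (j : Fin 4) (M : Fin 4 → ℕ) :
    (hermL2 M, (M j : ℂ) • hermL2 M) ∈ (minimalOp j).graph.topologicalClosure := by
  have hL : MemLp (L j (hermM M) : ℂ × ℂ → ℂ) 2 gaussMeasure := by
    rw [L_hermM]; exact memLp_smul_hermM _ _
  obtain ⟨u, v, huv, hu, hv⟩ := exists_tendsto_test j (f := hermM M) (memLp_herm _ _ _ _) hL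
    (memLp_A_hermM _ _) (memLp_A_hermM _ _)
  have e : hL.toLp _ = (M j : ℂ) • hermL2 M := by
    refine Lp.ext ?_
    filter_upwards [hL.coeFn_toLp, Lp.coeFn_smul (M j : ℂ) (hermL2 M),
      (memLp_herm (M 0) (M 1) (M 2) (M 3)).coeFn_toLp] with p h1 h2 h3
    rw [h1, h2, L_hermM]
    change _ = (M j : ℂ) • (hermL2 M) p
    rw [hermL2, h3]
    rfl
  rw [e] at hv
  exact mem_closure_of_tendsto (hu.prodMk_nhds hv)
    (.of_forall fun n => mem_graph_minimalOp j (huv n))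

/-- Each H_M is a limit of test functions by the cutoff argument, so completeness of the H_M makes
test functions dense. -/
lemma dense_domain_minimalOp (j : Fin 4) : Dense ((minimalOp j).domain : Set GaussL2) := by
  rw [Submodule.dense_iff_topologicalClosure_eq_top, eq_top_iff, ← span_hermL2_dense]
  refine Submodule.topologicalClosure_minimal _ (Submodule.span_le.2 ?_)
    (Submodule.isClosed_topologicalClosure _)
  rintro _ ⟨M, rfl⟩
  have h := map_mem_closure continuous_fst (hermL2_mem_closure_graph j M)
    (t := ((minimalOp j).domain : Set GaussL2))
    fun x hx => LinearPMap.mem_domain_of_mem_graph (y := x.2) hx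
  exact h

/-- A densely defined symmetric operator is contained in its adjoint, which is closed. -/
lemma isClosable_minimalOp (j : Fin 4) : (minimalOp j).IsClosable :=
  LinearPMap.isClosable_iff_exists_closed_extension.2 ⟨_,
    LinearPMap.adjoint_isClosed (dense_domain_minimalOp j),
    LinearPMap.IsFormalAdjoint.le_adjoint (dense_domain_minimalOp j) (minimalOp_symm j)⟩

lemma graph_realization (j : Fin 4) :
    (realization j).graph = (minimalOp j).graph.topologicalClosure :=
  (isClosable_minimalOp j).graph_closure_eq_closure_graph.symm

lemma realization_symm (j : Fin 4) : (realization j).IsFormalAdjoint (realization j) := by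
  have key : ∀ x ∈ closure ((minimalOp j).graph : Set (GaussL2 × GaussL2)),
      ∀ y ∈ closure ((minimalOp j).graph : Set (GaussL2 × GaussL2)),
      inner ℂ x.2 y.1 = inner ℂ x.1 y.2 := by
    intro x hx y hy
    have hc : IsClosed {q : (GaussL2 × GaussL2) × (GaussL2 × GaussL2) |
        inner ℂ q.1.2 q.2.1 = inner ℂ q.1.1 q.2.2} :=
      isClosed_eq (by fun_prop) (by fun_prop)
    have h2 : (x, y) ∈ closure (((minimalOp j).graph : Set (GaussL2 × GaussL2))
        ×ˢ ((minimalOp j).graph : Set (GaussL2 × GaussL2))) := by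
      rw [closure_prod_eq]; exact ⟨hx, hy⟩
    refine closure_minimal ?_ hc h2
    rintro ⟨a, b⟩ ⟨ha, hb⟩
    obtain ⟨a', ha1, ha2⟩ := ((minimalOp j).mem_graph_iff).1 ha
    obtain ⟨b', hb1, hb2⟩ := ((minimalOp j).mem_graph_iff).1 hb
    change inner ℂ a.2 b.1 = inner ℂ a.1 b.2
    rw [← ha1, ← ha2, ← hb1, ← hb2]
    exact minimalOp_symm j a' b'
  intro x y
  have hx := (realization j).mem_graph x
  have hy := (realization j).mem_graph y
  rw [graph_realization] at hx hy
  exact key _ hx _ hy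

lemma hermL2_ne_zero (M : Fin 4 → ℕ) : hermL2 M ≠ 0 := by
  intro h
  have h1 := (memLp_herm (M 0) (M 1) (M 2) (M 3)).coeFn_toLp
  have h2 : hermL2 M =ᵐ[gaussMeasure] 0 := (Lp.eq_zero_iff_ae_eq_zero).1 h
  have h3 := ((contDiff_smooth (herm (M 0) (M 1) (M 2) (M 3))).continuous.ae_eq_iff_eq
    gaussMeasure continuous_zero).1 (h1.symm.trans h2)
  exact herm_ne_zero _ _ _ _ (Subtype.ext h3)

/-- The Hermite polynomials diagonalize the closure of `S j`. -/
lemma isDiagonal_realization (j : Fin 4) :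
    IsDiagonal (realization j) hermL2 fun M => M j where
  isClosed := (isClosable_minimalOp j).closure_isClosed
  symm := realization_symm j
  mem_eigenspace M := by
    rw [mem_eigenspace_iff_mem_graph, graph_realization]
    exact hermL2_mem_closure_graph j M
  ne_zero := hermL2_ne_zero
  dense := span_hermL2_dense

end BivariateHermite

end

theorem mainTheorem6 (j : Fin 4) :
    BivariateHermite.S j = BivariateHermite.L j ∧
    IsSelfAdjoint (BivariateHermite.realization j) ∧
    BivariateHermite.HasPurelyDiscreteSpectrum (BivariateHermite.realization j) ∧
    BivariateHermite.spectrum (BivariateHermite.realization j) =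
      Set.range (fun l : ℕ => (l : ℂ)) ∧
    (∀ M : Fin 4 → ℕ, ∃ u : BivariateHermite.GaussL2,
      u =ᵐ[BivariateHermite.gaussMeasure] BivariateHermite.bivHermite M ∧ u ≠ 0 ∧
      u ∈ BivariateHermite.eigenspace (BivariateHermite.realization j) (M j)) ∧
    (∀ l : ℕ, BivariateHermite.eigenspace (BivariateHermite.realization j) l =
      (Submodule.span ℂ {u : BivariateHermite.GaussL2 | ∃ M : Fin 4 → ℕ, M j = l ∧
        u =ᵐ[BivariateHermite.gaussMeasure] BivariateHermite.bivHermite M}).topologicalClosure) := by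
  have hD := BivariateHermite.isDiagonal_realization j
  have hdeg : Function.Surjective fun M : Fin 4 → ℕ => M j := fun l => ⟨fun _ => l, rfl⟩
  refine ⟨BivariateHermite.S_eq_L j, hD.isSelfAdjoint, hD.hasPurelyDiscreteSpectrum hdeg,
    hD.spectrum_eq hdeg, fun M => ⟨BivariateHermite.hermL2 M, BivariateHermite.coeFn_hermL2 M,
      hD.ne_zero M, hD.mem_eigenspace M⟩, fun l => ?_⟩
  have hset : {u : BivariateHermite.GaussL2 | ∃ M : Fin 4 → ℕ, M j = l ∧
        u =ᵐ[BivariateHermite.gaussMeasure] BivariateHermite.bivHermite M}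
      = {u | ∃ M : Fin 4 → ℕ, M j = l ∧ u = BivariateHermite.hermL2 M} := by
    ext u
    refine exists_congr fun M => and_congr_right fun _ => ⟨fun h => ?_, fun h => ?_⟩
    · exact Lp.ext (h.trans (BivariateHermite.coeFn_hermL2 M).symm)
    · exact h ▸ BivariateHermite.coeFn_hermL2 M
  rw [hset]
  exact hD.eigenspace_eq l
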